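/- Let $n\ge 0$. A one-transit walk of length $2n$ is a lattice path $0=h_0,h_1,\dots,h_{2n}=0$ with $h_{k+1}-h_k=\pm1$ which, once it has been strictly below the axis, is never strictly above it again (the part above or the part below the axis may be empty). For $z_1,z_2>0$ give such a walk the weight obtained as the product of a factor $z_1$ for each down step and a factor $z_2$ for each up step, steps ending at height $0$ having factor $1$. Let $\langle\cdot\rangle_n=\langle\cdot\rangle_{n,z_1,z_2}$ be the average over one-transit walks of length $2n$ with respect to the probability proportional to this weight. For $1\le i\le n$ let $\hat a_i$ (resp. $\hat b_i$) be the indicator of a contact above (resp. below) the axis at site $2i$, i.e. of $h_{2i}=0$, $h_{2i-1}=1$ (resp. $h_{2i}=0$, $h_{2i-1}=-1$), and let $\hat a=\sum_{i=1}^n\hat a_i$, $\hat b=\sum_{i=1}^n\hat b_i$. Put $\rho(z)=\frac{1-2z}{1-z}$. 1. For all $z_1,z_2>0$ the limits $a(z_1,z_2)=\lim_{n\to\infty}\langle\hat a\rangle_n/n$ and $b(z_1,z_2)=\lim_{n\to\infty}\langle\hat b\rangle_n/n$ exist, and $$(a,b)=\begin{cases}(0,0) & z_1,z_2\ge 1/2,\\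 (\rho(z_1),0) & z_1<1/2,\ z_2>z_1,\\ (0,\rho(z_2)) & z_2<1/2,\ z_1>z_2,\\ (\rho(z)/2,\rho(z)/2) & z_1=z_2=z\le 1/2.\end{cases}$$ 2. There is a first-order transition along the line $z_1=z_2=z$, $0<z<1/2$: at every point $(z,z)$ of it the densities $a$ and $b$ and the difference $a-b$, as functions of $(z_1,z_2)$, are discontinuous, while the sum $a+b$ is continuous. 3. On the line $z_1=z_2=z$, $0<z\le 1/2$, the local profile is as follows: for every $x\in(0,1)$ and all integers $i_n$ with $i_n/n\to x$, $$\lim_{n\to\infty}\bigl(\langle\hat a_{i_n}\rangle_n,\langle\hat b_{i_n}\rangle_n\bigr)=\bigl(\rho(z)(1-x),\ \rho(z)\,x\bigr).$$ -/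

import Mathlib

open Filter Topology

namespace OTW

/-- The height, after `k` steps, of the lattice path started at height `0` with step sequence `w`,
where `true` is a North-East (up) step and `false` a South-East (down) step. -/
def height {N : ℕ} (w : Fin N → Bool) (k : ℕ) : ℤ :=
  ∑ j : Fin N, if (j : ℕ) < k then (if w j then 1 else -1) else 0

/-- One-transit walks of length `2 n`: the path ends at height `0` and, once it has been strictly
below the axis, it is never strictly above the axis again. The part above the axis or the part
below the axis may be empty. -/
def IsOneTransit {n : ℕ} (w : Fin (2 * n) → Bool) : Prop :=
  height w (2 * n) = 0 ∧
    ∀ i j : ℕ, i ≤ j → j ≤ 2 * n → height w i < 0 → height w j ≤ 0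

open Classical in
/-- The finite set of all one-transit walks of length `2 n`. -/
noncomputable def walks (n : ℕ) : Finset (Fin (2 * n) → Bool) :=
  Finset.univ.filter IsOneTransit

/-- The Boltzmann weight: a factor `z₁` for each down step and `z₂` for each up step, except that
the steps ending on the axis have factor `1`. -/
noncomputable def weight {n : ℕ} (z₁ z₂ : ℝ) (w : Fin (2 * n) → Bool) : ℝ :=
  ∏ j : Fin (2 * n),
    if height w ((j : ℕ) + 1) = 0 then 1 else if w j then z₂ else z₁

/-- The partition function of the one-transit walk model. -/
noncomputable def partitionFunction (n : ℕ) (z₁ z₂ : ℝ) : ℝ :=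
  ∑ w ∈ walks n, weight z₁ z₂ w

/-- The thermal average of an observable in the one-transit walk model. -/
noncomputable def mean (n : ℕ) (z₁ z₂ : ℝ) (f : (Fin (2 * n) → Bool) → ℝ) : ℝ :=
  (∑ w ∈ walks n, weight z₁ z₂ w * f w) / partitionFunction n z₁ z₂

/-- The walk has a contact above the axis at site `2 i`: it returns there to the axis from
height `1`. -/
def ContactAbove {N : ℕ} (w : Fin N → Bool) (i : ℕ) : Prop :=
  ∃ k : ℕ, k + 1 = 2 * i ∧ height w k = 1 ∧ height w (k + 1) = 0

/-- The walk has a contact below the axis at site `2 i`: it returns there to the axis from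
height `-1`. -/
def ContactBelow {N : ℕ} (w : Fin N → Bool) (i : ℕ) : Prop :=
  ∃ k : ℕ, k + 1 = 2 * i ∧ height w k = -1 ∧ height w (k + 1) = 0

open Classical in
/-- The contact operator above the axis at site `2 i`. -/
noncomputable def aHatAt {n : ℕ} (i : ℕ) (w : Fin (2 * n) → Bool) : ℝ :=
  if ContactAbove w i then 1 else 0

open Classical in
/-- The contact operator below the axis at site `2 i`. -/
noncomputable def bHatAt {n : ℕ} (i : ℕ) (w : Fin (2 * n) → Bool) : ℝ :=
  if ContactBelow w i then 1 else 0

/-- The total number of contacts above the axis. -/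
noncomputable def aHat {n : ℕ} (w : Fin (2 * n) → Bool) : ℝ :=
  ∑ i ∈ Finset.Icc 1 n, aHatAt i w

/-- The total number of contacts below the axis. -/
noncomputable def bHat {n : ℕ} (w : Fin (2 * n) → Bool) : ℝ :=
  ∑ i ∈ Finset.Icc 1 n, bHatAt i w

/-- The contact density `(1 - 2 z) / (1 - z)` of an adsorbed walk (only used for `z ≤ 1 / 2`). -/
noncomputable def rho (z : ℝ) : ℝ := (1 - 2 * z) / (1 - z)

end OTW

namespace OTW

/-! ### Heights and concatenation -/

/-! A walk of length $2n$ has $n$ steps of each kind, so its weight is $(z_1z_2)^n$ times $u=1/z_1$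
per contact above and $v=1/z_2$ per contact below (`weight_eq`). A one-transit walk splits uniquely
into a walk above the axis followed by one below, so the partition function reduces to
$T_n(u,v)=\sum_k A_k(u)A_{n-k}(v)$, with $A_n$ the contact polynomial of Dyck paths of semilength
$n$.

Removing the last arch gives $A=1+xuAC$, where $C=1+xC^2$ is the Catalan series. For $u=1/z$ this
reads $A(z-xC)=z$, and $(z-xC)(1-z-xC)=z(1-z)-x$: for $z<1/2$ a pole at $z(1-z)$ beats the
singularity $1/4$ of $C$. Concretely, for $z\le 1/2$ the sequence $r_n=A_n(1/z)(z(1-z))^n$ decreases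
to $1-zC(z(1-z))=\rho(z)$ (`renewal_tendsto`), and $c_n=T_n(1/z,1/z)(z(1-z))^n$ satisfies
$c_{n+1}=c_n+\rho(z)\,r_{n+1}$ (`coexistence_succ`).

Densities: the free energy is the logarithm of the larger of two growth rates
(`free_energy_tendsto`). Jensen's inequality bounds finite-size means by chords of the finite-size
log partition function, so the means converge to the derivative of the limit wherever it exists
(`tendsto_of_mul_le_sub`). On the diagonal with $z<1/2$ the maximum has a corner; moving both
fugacities together still gives $a+b$, and the two means are equal for every $n$. The jumps, and
$a+b=\rho(\min(z_1,z_2))$ near that line, follow.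

Profile: a contact at site $2i$ cuts the walk, so its probability is $r_ic_{n-i}/c_n$ above and
$(c_i-r_i)r_{n-i}/c_n$ below (`mean_aHatAt_eq`, `mean_bHatAt_eq`). For $z<1/2$, $c_n\sim\rho^2n$
makes these linear in $i/n$. -/

lemma height_zero {N : ℕ} (w : Fin N → Bool) : height w 0 = 0 := by simp [height]

lemma height_succ {N : ℕ} (w : Fin N → Bool) (j : Fin N) :
    height w (j + 1) = height w j + if w j then 1 else -1 := by
  have h : ∀ i : Fin N, (if (i : ℕ) < j + 1 then (if w i then (1 : ℤ) else -1) else 0) =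
      (if (i : ℕ) < j then (if w i then 1 else -1) else 0) +
        if i = j then (if w j then 1 else -1) else 0 := by
    intro i
    rcases lt_trichotomy i j with h | h | h
    · have : (i : ℕ) < j := h
      simp [this, h.ne, Nat.lt_succ_of_lt this]
    · subst h; simp
    · have h' : (j : ℕ) < i := h
      simp [h.ne', not_lt.2 h'.le, not_lt.2 (Nat.succ_le_of_lt h')]
  simp only [height]
  rw [Finset.sum_congr rfl fun i _ => h i, Finset.sum_add_distrib]
  simp

lemma height_succ_cases {N : ℕ} (w : Fin N → Bool) {k : ℕ} (hk : k < N) :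
    height w (k + 1) = height w k + 1 ∨ height w (k + 1) = height w k - 1 := by
  have h := height_succ w ⟨k, hk⟩
  simp only at h
  rw [h]
  split_ifs <;> simp [sub_eq_add_neg]

lemma height_parity {N : ℕ} (w : Fin N → Bool) {k : ℕ} (hk : k ≤ N) :
    height w k % 2 = (k : ℤ) % 2 := by
  induction k with
  | zero => simp [height_zero]
  | succ k ih =>
    have := ih (by omega)
    rcases height_succ_cases w (k := k) (by omega) with h | h <;> rw [h] <;> push_cast <;> omega

lemma height_append_left {M N : ℕ} (w₁ : Fin M → Bool) (w₂ : Fin N → Bool) {k : ℕ}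
    (hk : k ≤ M) : height (Fin.append w₁ w₂) k = height w₁ k := by
  simp only [height, Fin.sum_univ_add, Fin.val_castAdd, Fin.val_natAdd, Fin.append_left,
    Fin.append_right]
  have : ∀ j : Fin N, ¬ (M + (j : ℕ) < k) := fun j => by omega
  simp [this]

lemma height_append_right {M N : ℕ} (w₁ : Fin M → Bool) (w₂ : Fin N → Bool) (k : ℕ) :
    height (Fin.append w₁ w₂) (M + k) = height w₁ M + height w₂ k := by
  simp only [height, Fin.sum_univ_add, Fin.val_castAdd, Fin.val_natAdd, Fin.append_left,
    Fin.append_right]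
  have : ∀ j : Fin M, (j : ℕ) < M + k := fun j => by omega
  simp [this]

lemma height_not {N : ℕ} (w : Fin N → Bool) (k : ℕ) :
    height (fun j => !w j) k = - height w k := by
  simp only [height, ← Finset.sum_neg_distrib]
  refine Finset.sum_congr rfl fun j _ => ?_
  by_cases h : w j = true <;> by_cases hk : (j : ℕ) < k <;> simp [h, hk]

lemma sum_append {M N : ℕ} (f : (Fin (M + N) → Bool) → ℝ) :
    ∑ w, f w = ∑ w₁ : Fin M → Bool, ∑ w₂ : Fin N → Bool, f (Fin.append w₁ w₂) := by
  rw [← Fintype.sum_prod_type', ← (Fin.appendEquiv M N).sum_comp]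
  rfl

/-- The device behind every factorisation below: a class of walks cut at a fixed time on the axis
has a product as its generating sum. -/
lemma sum_append_mul {M N : ℕ} {f : (Fin (M + N) → Bool) → ℝ} {g : (Fin M → Bool) → ℝ}
    {h : (Fin N → Bool) → ℝ} (H : ∀ w₁ w₂, f (Fin.append w₁ w₂) = g w₁ * h w₂) :
    ∑ w, f w = (∑ w, g w) * ∑ w, h w := by
  rw [sum_append, Finset.sum_mul_sum]
  simp only [H]

/-! ### Contact weights -/

/-- The contact weight: a factor `u` for each contact above the axis and `v` for each contact
below the axis. -/
noncomputable def contactWeight {N : ℕ} (u v : ℝ) (w : Fin N → Bool) : ℝ :=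
  ∏ k ∈ Finset.range N, (if height w k = 1 ∧ height w (k + 1) = 0 then u else 1) *
    (if height w k = -1 ∧ height w (k + 1) = 0 then v else 1)

/-- A contact involves a single step, and no step straddles the junction; since the junction is on
the axis, the second walk keeps its heights. -/
lemma contactWeight_append {M N : ℕ} (u v : ℝ) (w₁ : Fin M → Bool) (w₂ : Fin N → Bool)
    (h : height w₁ M = 0) :
    contactWeight u v (Fin.append w₁ w₂) = contactWeight u v w₁ * contactWeight u v w₂ := by
  simp only [contactWeight, Finset.prod_range_add]
  congr 1
  · refine Finset.prod_congr rfl fun k hk => ?_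
    rw [Finset.mem_range] at hk
    rw [height_append_left _ _ hk.le, height_append_left _ _ hk]
  · refine Finset.prod_congr rfl fun k _ => ?_
    rw [add_assoc, height_append_right, height_append_right, h, zero_add, zero_add]

lemma contactWeight_not {N : ℕ} (u v : ℝ) (w : Fin N → Bool) :
    contactWeight u v (fun j => !w j) = contactWeight v u w := by
  simp only [contactWeight, height_not]
  refine Finset.prod_congr rfl fun k _ => ?_
  rw [mul_comm]
  simp [neg_eq_iff_eq_neg]

lemma contactWeight_one_one {N : ℕ} (w : Fin N → Bool) : contactWeight 1 1 w = 1 := by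
  simp [contactWeight]

lemma contactWeight_pos {N : ℕ} {u v : ℝ} (hu : 0 < u) (hv : 0 < v) (w : Fin N → Bool) :
    0 < contactWeight u v w :=
  Finset.prod_pos fun k _ => by split_ifs <;> positivity

lemma contactWeight_mono_left {N : ℕ} {u u' v : ℝ} (hu : 0 < u) (huu : u ≤ u') (hv : 0 < v)
    (w : Fin N → Bool) : contactWeight u v w ≤ contactWeight u' v w := by
  refine Finset.prod_le_prod (fun k _ => by split_ifs <;> positivity) fun k _ => ?_
  refine mul_le_mul_of_nonneg_right ?_ (by split_ifs <;> positivity)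
  split_ifs <;> simp [huu]

/-! ### Classes of walks -/

/-- The walk ends on the axis and is never below it. -/
def IsAbove {N : ℕ} (w : Fin N → Bool) : Prop :=
  height w N = 0 ∧ ∀ k ≤ N, 0 ≤ height w k

/-- The walk ends on the axis and is never above it. -/
def IsBelow {N : ℕ} (w : Fin N → Bool) : Prop :=
  height w N = 0 ∧ ∀ k ≤ N, height w k ≤ 0

/-- The walk ends on the axis and is strictly above it in between. -/
def IsArch {N : ℕ} (w : Fin N → Bool) : Prop :=
  height w N = 0 ∧ ∀ k, 0 < k → k < N → 0 < height w k

/-- The walk ends on the axis and is never above it after having been below it. -/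
def IsTransit {N : ℕ} (w : Fin N → Bool) : Prop :=
  height w N = 0 ∧ ∀ i j : ℕ, i ≤ j → j ≤ N → height w i < 0 → height w j ≤ 0

lemma IsAbove.isTransit {N : ℕ} {w : Fin N → Bool} (h : IsAbove w) : IsTransit w :=
  ⟨h.1, fun i _ hij hj hi => absurd (h.2 i (hij.trans hj)) (not_le.2 hi)⟩

lemma isBelow_not {N : ℕ} (w : Fin N → Bool) : IsBelow (fun j => !w j) ↔ IsAbove w := by
  simp [IsBelow, IsAbove, height_not]

lemma IsAbove.contactWeight_eq {N : ℕ} {w : Fin N → Bool} (h : IsAbove w) (u v : ℝ) :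
    contactWeight u v w = contactWeight u u w := by
  refine Finset.prod_congr rfl fun k hk => ?_
  rw [Finset.mem_range] at hk
  have := h.2 k hk.le
  have h1 : ¬ (height w k = -1 ∧ height w (k + 1) = 0) := fun h' => by omega
  rw [if_neg h1, if_neg h1]

open Classical in
/-- The generating polynomial, by contacts, of walks of length `N` above the axis. -/
noncomputable def aboveSum (N : ℕ) (u : ℝ) : ℝ :=
  ∑ w : Fin N → Bool, if IsAbove w then contactWeight u u w else 0

open Classical in
/-- The generating polynomial, by contacts, of one-transit walks of length `N`. -/
noncomputable def transitSum (N : ℕ) (u v : ℝ) : ℝ :=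
  ∑ w : Fin N → Bool, if IsTransit w then contactWeight u v w else 0

open Classical in
lemma sum_isBelow (N : ℕ) (u v : ℝ) :
    ∑ w : Fin N → Bool, (if IsBelow w then contactWeight u v w else 0) = aboveSum N v := by
  have hinv : Function.Involutive (fun (w : Fin N → Bool) j => !w j) := fun w => by simp
  rw [aboveSum, ← Equiv.sum_comp hinv.toPerm]
  refine Finset.sum_congr rfl fun w _ => ?_
  simp only [Function.Involutive.coe_toPerm, isBelow_not, contactWeight_not]
  split_ifs with h
  · exact h.contactWeight_eq v u
  · rfl

open Classical in
lemma sum_isAbove (N : ℕ) (u v : ℝ) :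
    ∑ w : Fin N → Bool, (if IsAbove w then contactWeight u v w else 0) = aboveSum N u := by
  refine Finset.sum_congr rfl fun w _ => ?_
  split_ifs with h
  · exact h.contactWeight_eq u v
  · rfl

lemma aboveSum_odd {N : ℕ} (hN : N % 2 = 1) (u : ℝ) : aboveSum N u = 0 := by
  refine Finset.sum_eq_zero fun w _ => if_neg fun h => ?_
  have := height_parity w le_rfl
  rw [h.1] at this
  omega

lemma sum_range_even {f : ℕ → ℝ} (hf : ∀ k, k % 2 = 1 → f k = 0) (n : ℕ) :
    ∑ k ∈ Finset.range (2 * n + 1), f k = ∑ k ∈ Finset.range (n + 1), f (2 * k) := by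
  induction n with
  | zero => simp
  | succ n ih =>
    rw [show 2 * (n + 1) + 1 = 2 * n + 1 + 1 + 1 by ring, Finset.sum_range_succ,
      Finset.sum_range_succ, ih, Finset.sum_range_succ _ (n + 1), hf (2 * n + 1) (by omega)]
    simp [mul_add]

/-! ### Transit decomposition -/

/-- The walk is above the axis until time `j`, when it is on the axis, and below afterwards. -/
def IsSplitAt {N : ℕ} (w : Fin N → Bool) (j : ℕ) : Prop :=
  height w j = 0 ∧ height w N = 0 ∧ (∀ k ≤ j, 0 ≤ height w k) ∧
    ∀ k, j ≤ k → k ≤ N → height w k ≤ 0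

lemma IsSplitAt.isTransit {N : ℕ} {w : Fin N → Bool} {j : ℕ} (h : IsSplitAt w j) :
    IsTransit w := by
  refine ⟨h.2.1, fun i k hik hk hi => h.2.2.2 k ?_ hk⟩
  by_contra hjk
  have := h.2.2.1 i (by omega)
  omega

/-- Just after the earlier of two split times the height would be both nonpositive and nonnegative,
yet it is $\pm1$. -/
lemma IsSplitAt.le {N : ℕ} {w : Fin N → Bool} {j j' : ℕ} (h : IsSplitAt w j)
    (h' : IsSplitAt w j') (hj' : j' ≤ N) : j' ≤ j := by
  by_contra hlt
  have h1 := h.2.2.2 (j + 1) (by omega) (by omega)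
  have h2 := h'.2.2.1 (j + 1) (by omega)
  have h3 := h.1
  rcases height_succ_cases w (k := j) (by omega) with h4 | h4 <;> omega

lemma IsTransit.exists_isSplitAt {N : ℕ} {w : Fin N → Bool} (h : IsTransit w) :
    ∃ j ≤ N, IsSplitAt w j := by
  classical
  -- A walk that never goes below splits at its end; otherwise the split is one step before the
  -- first time below the axis.
  by_cases hA : ∀ k ≤ N, 0 ≤ height w k
  · exact ⟨N, le_rfl, h.1, h.1, hA, fun k h1 h2 => by rw [le_antisymm h2 h1, h.1]⟩
  push Not at hA
  let m := Nat.find hA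
  obtain ⟨hm1, hm2⟩ : m ≤ N ∧ height w m < 0 := Nat.find_spec hA
  have hmin : ∀ k, k < m → 0 ≤ height w k := fun k hk => by
    have := Nat.find_min hA hk
    push Not at this
    exact this (by omega)
  have hm0 : m ≠ 0 := fun h0 => by rw [h0, height_zero] at hm2; omega
  obtain ⟨j, hj⟩ := Nat.exists_eq_succ_of_ne_zero hm0
  have h0 := hmin j (by omega)
  have hj0 : height w j = 0 := by
    rcases height_succ_cases w (k := j) (by omega) with h4 | h4 <;>
      rw [hj, Nat.succ_eq_add_one] at hm2 <;> omega
  refine ⟨j, by omega, hj0, h.1, fun k hk => hmin k (by omega), fun k hk hkN => ?_⟩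
  rcases hk.eq_or_lt with rfl | hk
  · exact hj0.le
  · exact h.2 m k (by omega) hkN hm2

lemma isSplitAt_append {M N : ℕ} (w₁ : Fin M → Bool) (w₂ : Fin N → Bool) :
    IsSplitAt (Fin.append w₁ w₂) M ↔ IsAbove w₁ ∧ IsBelow w₂ := by
  constructor
  · rintro ⟨h1, h2, h3, h4⟩
    rw [height_append_left _ _ le_rfl] at h1
    rw [height_append_right, h1, zero_add] at h2
    refine ⟨⟨h1, fun k hk => ?_⟩, h2, fun k hk => ?_⟩
    · simpa [height_append_left _ _ hk] using h3 k hk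
    · simpa [height_append_right, h1] using h4 (M + k) (by omega) (by omega)
  · rintro ⟨⟨h1, h2⟩, h3, h4⟩
    refine ⟨by rw [height_append_left _ _ le_rfl, h1], by rw [height_append_right, h1, h3]; rfl,
      fun k hk => ?_, fun k hk hk' => ?_⟩
    · rw [height_append_left _ _ hk]; exact h2 k hk
    · obtain ⟨l, rfl⟩ := Nat.exists_eq_add_of_le hk
      rw [height_append_right, h1, zero_add]; exact h4 l (by omega)

open Classical in
lemma sum_isSplitAt {N j : ℕ} (hj : j ≤ N) (u v : ℝ) :
    ∑ w : Fin N → Bool, (if IsSplitAt w j then contactWeight u v w else 0) =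
      aboveSum j u * aboveSum (N - j) v := by
  obtain ⟨l, rfl⟩ := Nat.exists_eq_add_of_le hj
  rw [Nat.add_sub_cancel_left, ← sum_isAbove j u v, ← sum_isBelow l u v]
  refine sum_append_mul fun w₁ w₂ => ?_
  rw [isSplitAt_append]
  by_cases h1 : IsAbove w₁
  · by_cases h2 : IsBelow w₂
    · simp [h1, h2, contactWeight_append u v w₁ w₂ h1.1]
    · simp [h2]
  · simp [h1]

lemma transitSum_eq_sum (N : ℕ) (u v : ℝ) :
    transitSum N u v = ∑ j ∈ Finset.range (N + 1), aboveSum j u * aboveSum (N - j) v := by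
  classical
  rw [Finset.sum_congr rfl fun j hj =>
    (sum_isSplitAt (Nat.lt_succ_iff.1 (Finset.mem_range.1 hj)) u v).symm, Finset.sum_comm]
  refine Finset.sum_congr rfl fun w _ => ?_
  split_ifs with h
  · obtain ⟨j, hj, hs⟩ := h.exists_isSplitAt
    rw [Finset.sum_eq_single j]
    · rw [if_pos hs]
    · intro j' hj' hne
      rw [Finset.mem_range] at hj'
      exact if_neg fun hs' => hne (le_antisymm (hs.le hs' (by omega)) (hs'.le hs hj))
    · intro hj'
      exact absurd (Finset.mem_range.2 (by omega)) hj'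
  · exact (Finset.sum_eq_zero fun j _ => if_neg fun hs => h hs.isTransit).symm

lemma transitSum_even (n : ℕ) (u v : ℝ) :
    transitSum (2 * n) u v =
      ∑ k ∈ Finset.range (n + 1), aboveSum (2 * k) u * aboveSum (2 * (n - k)) v := by
  rw [transitSum_eq_sum, sum_range_even]
  · simp only [Nat.mul_sub]
  · intro k hk
    rw [aboveSum_odd hk, zero_mul]

/-! ### Arch decomposition -/

/-- Time `j` is the last visit to the axis before the end of the walk. -/
def IsLastZero {N : ℕ} (w : Fin N → Bool) (j : ℕ) : Prop :=
  height w j = 0 ∧ ∀ k, j < k → k < N → 0 < height w k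

lemma IsAbove.exists_isLastZero {N : ℕ} {w : Fin N → Bool} (h : IsAbove w) (hN : 0 < N) :
    ∃ j < N, IsLastZero w j := by
  classical
  let j := Nat.findGreatest (fun j => height w j = 0) (N - 1)
  have hj : height w j = 0 :=
    Nat.findGreatest_spec (P := fun j => height w j = 0) (Nat.zero_le _) (height_zero w)
  have hjN : j ≤ N - 1 := Nat.findGreatest_le _
  refine ⟨j, by omega, hj, fun k hk hkN => lt_of_le_of_ne (h.2 k hkN.le) fun h0 => ?_⟩
  exact Nat.findGreatest_is_greatest (P := fun j => height w j = 0) hk (by omega) h0.symm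

lemma IsLastZero.le {N : ℕ} {w : Fin N → Bool} {j j' : ℕ} (h : IsLastZero w j)
    (h' : IsLastZero w j') (hj' : j' < N) : j' ≤ j := by
  by_contra hlt
  have := h.2 j' (by omega) hj'
  have := h'.1
  omega

lemma isAbove_isLastZero_append {M N : ℕ} (w₁ : Fin M → Bool) (w₂ : Fin N → Bool) :
    (IsAbove (Fin.append w₁ w₂) ∧ IsLastZero (Fin.append w₁ w₂) M) ↔
      IsAbove w₁ ∧ IsArch w₂ := by
  constructor
  · rintro ⟨⟨h1, h2⟩, h3, h4⟩
    rw [height_append_left _ _ le_rfl] at h3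
    rw [height_append_right, h3, zero_add] at h1
    refine ⟨⟨h3, fun k hk => ?_⟩, h1, fun k hk hk' => ?_⟩
    · simpa [height_append_left _ _ hk] using h2 k (by omega)
    · simpa [height_append_right, h3] using h4 (M + k) (by omega) (by omega)
  · rintro ⟨⟨h1, h2⟩, h3, h4⟩
    refine ⟨⟨by rw [height_append_right, h1, h3]; rfl, fun k hk => ?_⟩,
      by rw [height_append_left _ _ le_rfl, h1], fun k hk hk' => ?_⟩
    · rcases le_total k M with hkM | hkM
      · rw [height_append_left _ _ hkM]; exact h2 k hkM
      · obtain ⟨l, rfl⟩ := Nat.exists_eq_add_of_le hkM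
        rw [height_append_right, h1, zero_add]
        rcases Nat.eq_zero_or_pos l with rfl | hl
        · rw [height_zero]
        rcases (show l ≤ N by omega).eq_or_lt with rfl | hlN
        · rw [h3]
        · exact (h4 l hl hlN).le
    · obtain ⟨l, rfl⟩ := Nat.exists_eq_add_of_le hk.le
      rw [height_append_right, h1, zero_add]; exact h4 l (by omega) (by omega)

open Classical in
/-- The generating polynomial, by contacts, of arches of length `N`. -/
noncomputable def archSum (N : ℕ) (u : ℝ) : ℝ :=
  ∑ w : Fin N → Bool, if IsArch w then contactWeight u u w else 0

/-- Cutting at the last visit to the axis before the end leaves a final arch. Positive length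
guarantees such a visit, at worst at time $0$. -/
lemma aboveSum_eq_sum {N : ℕ} (hN : 0 < N) (u : ℝ) :
    aboveSum N u = ∑ j ∈ Finset.range N, aboveSum j u * archSum (N - j) u := by
  classical
  have key : ∀ j ∈ Finset.range N, aboveSum j u * archSum (N - j) u =
      ∑ w : Fin N → Bool, if IsAbove w ∧ IsLastZero w j then contactWeight u u w else 0 := by
    intro j hj
    obtain ⟨l, rfl⟩ := Nat.exists_eq_add_of_le (Finset.mem_range.1 hj).le
    rw [Nat.add_sub_cancel_left]
    refine (sum_append_mul fun w₁ w₂ => ?_).symm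
    rw [if_congr (isAbove_isLastZero_append w₁ w₂) rfl rfl]
    by_cases h1 : IsAbove w₁
    · by_cases h2 : IsArch w₂
      · simp [h1, h2, contactWeight_append u u w₁ w₂ h1.1]
      · simp [h2]
    · simp [h1]
  rw [Finset.sum_congr rfl key, Finset.sum_comm]
  refine Finset.sum_congr rfl fun w _ => ?_
  split_ifs with h
  · obtain ⟨j, hj, hs⟩ := h.exists_isLastZero hN
    rw [Finset.sum_eq_single j]
    · rw [if_pos ⟨h, hs⟩]
    · intro j' hj' hne
      rw [Finset.mem_range] at hj'
      exact if_neg fun hs' => hne (le_antisymm (hs.le hs'.2 hj') (hs'.2.le hs hj))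
    · intro hj'
      exact absurd (Finset.mem_range.2 hj) hj'
  · exact (Finset.sum_eq_zero fun j _ => if_neg fun hs => h hs.1).symm

/-- Without its first and last steps an arch is a walk seen from height $1$, where strict positivity
becomes nonnegativity. -/
lemma isArch_append {N : ℕ} (a : Fin 1 → Bool) (w : Fin N → Bool) (b : Fin 1 → Bool) :
    IsArch (Fin.append (Fin.append a w) b) ↔ a 0 = true ∧ IsAbove w ∧ b 0 = false := by
  have h1 : ∀ c : Fin 1 → Bool, height c 1 = if c 0 then 1 else -1 := fun c => by simp [height]
  have hin : ∀ k ≤ N, height (Fin.append (Fin.append a w) b) (k + 1) = height a 1 + height w k := by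
    intro k hk
    rw [height_append_left _ _ (by omega), add_comm k 1, height_append_right]
  have hend : height (Fin.append (Fin.append a w) b) (1 + N + 1) =
      height a 1 + height w N + height b 1 := by
    rw [height_append_right, height_append_right]
  have hpos : (∀ k, 0 < k → k < 1 + N + 1 →
      0 < height (Fin.append (Fin.append a w) b) k) ↔
      ∀ k ≤ N, 0 < height a 1 + height w k := by
    constructor
    · intro h k hk
      rw [← hin k hk]
      exact h _ (by omega) (by omega)
    · intro h k hk hk'
      obtain ⟨l, rfl⟩ := Nat.exists_eq_succ_of_ne_zero hk.ne'
      rw [Nat.succ_eq_add_one, hin l (by omega)]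
      exact h l (by omega)
  rw [IsArch, hend, hpos, h1, h1, IsAbove]
  constructor
  · rintro ⟨h2, h3⟩
    have ha := h3 0 (by omega)
    rw [height_zero] at ha
    have ha' : a 0 = true := by by_contra hn; simp [hn] at ha
    simp only [ha', if_true] at h2 h3
    have hN := h3 N le_rfl
    have hb : b 0 = false := by
      by_contra hn
      simp only [Bool.not_eq_false] at hn
      simp only [hn, if_true] at h2
      omega
    simp only [hb] at h2
    refine ⟨ha', ⟨by simpa using h2, fun k hk => ?_⟩, hb⟩
    have := h3 k hk
    omega
  · rintro ⟨ha, ⟨h2, h3⟩, hb⟩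
    simp only [ha, hb, h2]
    refine ⟨by simp, fun k hk => ?_⟩
    have := h3 k hk
    simp only [if_true]
    omega

lemma IsArch.contactWeight {N : ℕ} {w : Fin (N + 2) → Bool} (h : IsArch w) (u v : ℝ) :
    contactWeight u v w = u := by
  have hlast : height w (N + 1) = 1 := by
    have h1 := h.2 (N + 1) (by omega) (by omega)
    have h2 : height w (N + 1 + 1) = 0 := h.1
    rcases height_succ_cases w (k := N + 1) (by omega) with h3 | h3 <;> omega
  rw [OTW.contactWeight, Finset.prod_range_succ, hlast, h.1, Finset.prod_eq_one]
  · norm_num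
  · intro k hk
    rw [Finset.mem_range] at hk
    have := h.2 (k + 1) (by omega) (by omega)
    simp [this.ne']

/-- An arch has a single contact, its last step; the contacts of the inner walk occur at height $1$
and do not count, hence the argument $1$. -/
lemma archSum_add_two (N : ℕ) (u : ℝ) : archSum (N + 2) u = u * aboveSum N 1 := by
  classical
  have h1 : archSum (N + 2) u = u * ∑ w : Fin (N + 2) → Bool, if IsArch w then (1 : ℝ) else 0 := by
    rw [Finset.mul_sum]
    refine Finset.sum_congr rfl fun w _ => ?_
    split_ifs with h
    · rw [h.contactWeight, mul_one]
    · rw [mul_zero]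
  -- Transport of the length $N+2$ to the form $1+N+1$ under which `Fin.append` splits off both end
  -- steps.
  have hcongr : ∀ K, N + 2 = K → (∑ w : Fin (N + 2) → Bool, if IsArch w then (1 : ℝ) else 0) =
      ∑ w : Fin K → Bool, if IsArch w then (1 : ℝ) else 0 := by
    rintro _ rfl
    rfl
  rw [h1, hcongr (1 + N + 1) (by ring)]
  congr 1
  have hone : ∀ f : (Fin 1 → Bool) → ℝ, ∑ a, f a = f (fun _ => true) + f (fun _ => false) := by
    intro f
    rw [← (Equiv.funUnique (Fin 1) Bool).symm.sum_comp, Fintype.sum_bool]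
    rfl
  rw [sum_append, sum_append, hone, aboveSum]
  simp [hone, isArch_append, contactWeight_one_one]

lemma aboveSum_zero (u : ℝ) : aboveSum 0 u = 1 := by
  have : ∀ w : Fin 0 → Bool, IsAbove w := fun w => ⟨by simp [height], fun k _ => by simp [height]⟩
  simp [aboveSum, this, contactWeight]

lemma aboveSum_even_succ (n : ℕ) (u : ℝ) :
    aboveSum (2 * (n + 1)) u =
      u * ∑ k ∈ Finset.range (n + 1), aboveSum (2 * k) u * aboveSum (2 * (n - k)) 1 := by
  rw [aboveSum_eq_sum (by omega), mul_add, Finset.sum_range_succ, aboveSum_odd (by omega),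
    zero_mul, add_zero, sum_range_even, Finset.mul_sum]
  · refine Finset.sum_congr rfl fun k hk => ?_
    rw [Finset.mem_range] at hk
    rw [show 2 * n + 2 * 1 - 2 * k = 2 * (n - k) + 2 by omega, archSum_add_two]
    ring
  · intro k hk
    rw [aboveSum_odd hk, zero_mul]

/-! ### Contacts at a given site -/

/-- Arriving from height $1$ excludes any earlier excursion below, while nothing constrains what
follows beyond the transit condition. -/
lemma contactAbove_append {i N : ℕ} (hi : 0 < i) (w₁ : Fin (2 * i) → Bool) (w₂ : Fin N → Bool) :
    (IsTransit (Fin.append w₁ w₂) ∧ ContactAbove (Fin.append w₁ w₂) i) ↔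
      IsAbove w₁ ∧ IsTransit w₂ := by
  constructor
  · rintro ⟨⟨h1, h2⟩, k, hk, h3, h4⟩
    rw [hk, height_append_left _ _ le_rfl] at h4
    rw [height_append_right, h4, zero_add] at h1
    refine ⟨⟨h4, fun l hl => ?_⟩, h1, fun p q hpq hq hp => ?_⟩
    · rcases hl.eq_or_lt with rfl | hl
      · exact h4.ge
      · by_contra hneg
        have := h2 l k (by omega) (by omega)
          (by rw [height_append_left _ _ hl.le]; omega)
        omega
    · have := h2 (2 * i + p) (2 * i + q) (by omega) (by omega)
      rw [height_append_right, height_append_right, h4, zero_add, zero_add] at this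
      exact this hp
  · rintro ⟨⟨h1, h2⟩, h3, h4⟩
    refine ⟨⟨by rw [height_append_right, h1, h3]; rfl, fun p q hpq hq hp => ?_⟩, 2 * i - 1,
      by omega, ?_, ?_⟩
    · rcases le_total p (2 * i) with hpi | hpi
      · rw [height_append_left _ _ hpi] at hp
        exact absurd (h2 p hpi) (not_le.2 hp)
      · obtain ⟨p, rfl⟩ := Nat.exists_eq_add_of_le hpi
        obtain ⟨q, rfl⟩ := Nat.exists_eq_add_of_le (hpi.trans hpq)
        rw [height_append_right, h1, zero_add] at hp ⊢
        exact h4 p q (by omega) (by omega) hp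
    · rw [height_append_left _ _ (by omega)]
      have h5 := h2 (2 * i - 1) (by omega)
      have h6 := height_succ_cases w₁ (k := 2 * i - 1) (by omega)
      rw [show 2 * i - 1 + 1 = 2 * i by omega, h1] at h6
      omega
    · rw [show 2 * i - 1 + 1 = 2 * i by omega, height_append_left _ _ le_rfl, h1]

/-- Arriving from $-1$ forbids any later visit above. Conversely, a transit walk that has been below
can only reach its end from $-1$. -/
lemma contactBelow_append {i N : ℕ} (hi : 0 < i) (w₁ : Fin (2 * i) → Bool) (w₂ : Fin N → Bool) :
    (IsTransit (Fin.append w₁ w₂) ∧ ContactBelow (Fin.append w₁ w₂) i) ↔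
      (IsTransit w₁ ∧ ¬ IsAbove w₁) ∧ IsBelow w₂ := by
  constructor
  · rintro ⟨⟨h1, h2⟩, k, hk, h3, h4⟩
    rw [hk, height_append_left _ _ le_rfl] at h4
    rw [height_append_right, h4, zero_add] at h1
    refine ⟨⟨⟨h4, fun p q hpq hq hp => ?_⟩, fun hA => ?_⟩, h1, fun l hl => ?_⟩
    · have := h2 p q hpq (by omega)
      rw [height_append_left _ _ hq, height_append_left _ _ (by omega)] at this
      exact this hp
    · have := hA.2 k (by omega)
      rw [height_append_left _ _ (by omega)] at h3
      omega
    · have := h2 k (2 * i + l) (by omega) (by omega) (by omega)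
      rwa [height_append_right, h4, zero_add] at this
  · rintro ⟨⟨⟨h1, h2⟩, hA⟩, h3, h4⟩
    refine ⟨⟨by rw [height_append_right, h1, h3]; rfl, fun p q hpq hq hp => ?_⟩, 2 * i - 1,
      by omega, ?_, ?_⟩
    · rcases le_total q (2 * i) with hqi | hqi
      · rw [height_append_left _ _ hqi]
        rw [height_append_left _ _ (by omega)] at hp
        exact h2 p q hpq hqi hp
      · obtain ⟨q, rfl⟩ := Nat.exists_eq_add_of_le hqi
        rw [height_append_right, h1, zero_add]
        exact h4 q (by omega)
    · rw [height_append_left _ _ (by omega)]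
      obtain ⟨l, hl, hneg⟩ : ∃ l ≤ 2 * i, height w₁ l < 0 := by
        by_contra hno
        push Not at hno
        exact hA ⟨h1, hno⟩
      have hl' : l ≠ 2 * i := fun h => by rw [h, h1] at hneg; omega
      have h5 := h2 l (2 * i - 1) (by omega) (by omega) hneg
      have h6 := height_succ_cases w₁ (k := 2 * i - 1) (by omega)
      rw [show 2 * i - 1 + 1 = 2 * i by omega, h1] at h6
      omega
    · rw [show 2 * i - 1 + 1 = 2 * i by omega, height_append_left _ _ le_rfl, h1]

open Classical in
lemma sum_contactAbove {i N : ℕ} (hi : 0 < i) (hN : 2 * i ≤ N) (u v : ℝ) :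
    ∑ w : Fin N → Bool, (if IsTransit w ∧ ContactAbove w i then contactWeight u v w else 0) =
      aboveSum (2 * i) u * transitSum (N - 2 * i) u v := by
  obtain ⟨l, rfl⟩ := Nat.exists_eq_add_of_le hN
  rw [Nat.add_sub_cancel_left, ← sum_isAbove _ u v]
  refine sum_append_mul fun w₁ w₂ => ?_
  rw [if_congr (contactAbove_append hi w₁ w₂) rfl rfl]
  by_cases h1 : IsAbove w₁
  · by_cases h2 : IsTransit w₂
    · simp [h1, h2, contactWeight_append u v w₁ w₂ h1.1]
    · simp [h2]
  · simp [h1]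

open Classical in
lemma sum_contactBelow {i N : ℕ} (hi : 0 < i) (hN : 2 * i ≤ N) (u v : ℝ) :
    ∑ w : Fin N → Bool, (if IsTransit w ∧ ContactBelow w i then contactWeight u v w else 0) =
      (transitSum (2 * i) u v - aboveSum (2 * i) u) * aboveSum (N - 2 * i) v := by
  obtain ⟨l, rfl⟩ := Nat.exists_eq_add_of_le hN
  rw [Nat.add_sub_cancel_left, ← sum_isAbove _ u v, transitSum, ← Finset.sum_sub_distrib,
    ← sum_isBelow l u v]
  refine sum_append_mul fun w₁ w₂ => ?_
  rw [if_congr (contactBelow_append hi w₁ w₂) rfl rfl]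
  by_cases h1 : IsAbove w₁
  · simp [h1, h1.isTransit]
  · by_cases h0 : IsTransit w₁
    · by_cases h2 : IsBelow w₂
      · simp [h1, h0, h2, contactWeight_append u v w₁ w₂ h0.1]
      · simp [h2]
    · simp [h1, h0]

end OTW

namespace OTW

/-! ### Generating functions -/

section GeneratingFunction

open PowerSeries

/-- The generating function, by semilength, of walks above the axis. -/
noncomputable def aboveSeries (u : ℝ) : ℝ⟦X⟧ := PowerSeries.mk fun n => aboveSum (2 * n) u

/-- The generating function, by semilength, of one-transit walks with equal contact weights. -/
noncomputable def transitSeries (u : ℝ) : ℝ⟦X⟧ := PowerSeries.mk fun n => transitSum (2 * n) u u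

lemma aboveSeries_eq (u : ℝ) :
    aboveSeries u = 1 + X * (C u * (aboveSeries u * aboveSeries 1)) := by
  ext n
  cases n with
  | zero => simp [aboveSeries, aboveSum_zero]
  | succ n =>
    rw [map_add, coeff_succ_X_mul, coeff_C_mul, coeff_mul,
      Finset.Nat.sum_antidiagonal_eq_sum_range_succ_mk]
    simp only [aboveSeries, coeff_mk, aboveSum_even_succ]
    simp [coeff_one]

lemma transitSeries_eq (u : ℝ) : transitSeries u = aboveSeries u * aboveSeries u := by
  ext n
  rw [coeff_mul, Finset.Nat.sum_antidiagonal_eq_sum_range_succ_mk]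
  simp only [transitSeries, aboveSeries, coeff_mk, transitSum_even]

lemma aboveSeries_mul_eq {z : ℝ} (hz : z ≠ 0) :
    aboveSeries z⁻¹ * (C z - X * aboveSeries 1) = C z := by
  have h := aboveSeries_eq z⁻¹
  have hc : (C z : ℝ⟦X⟧) * C z⁻¹ = 1 := by rw [← map_mul, mul_inv_cancel₀ hz, map_one]
  linear_combination (C z) * h + X * (aboveSeries z⁻¹ * aboveSeries 1) * hc

lemma catalanSeries_eq : aboveSeries 1 = 1 + X * (aboveSeries 1 * aboveSeries 1) := by
  have := aboveSeries_eq 1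
  rwa [map_one, one_mul] at this

/-- Multiplying by the conjugate factor $1-z-xC$ turns the kernel $z-xC$ into the polynomial
$z(1-z)-x$, by the Catalan equation. -/
lemma aboveSeries_mul_sub {z : ℝ} (hz : z ≠ 0) :
    aboveSeries z⁻¹ * (C z * (1 - C z) - X) = C z * (1 - C z - X * aboveSeries 1) := by
  linear_combination (1 - C z - X * aboveSeries 1) * aboveSeries_mul_eq hz +
    X * aboveSeries z⁻¹ * catalanSeries_eq

/-- One factor $A$ of $A^2$ absorbs the polynomial kernel; then $1-z-xC=(1-2z)+(z-xC)$, and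
$A(z-xC)=z$. -/
lemma transitSeries_mul_sub {z : ℝ} (hz : z ≠ 0) :
    transitSeries z⁻¹ * (C z * (1 - C z) - X) =
      C z * C z + C z * (1 - 2 * C z) * aboveSeries z⁻¹ := by
  rw [transitSeries_eq]
  linear_combination aboveSeries z⁻¹ * aboveSeries_mul_sub hz + C z * aboveSeries_mul_eq hz

lemma aboveSum_recurrence {z : ℝ} (hz : z ≠ 0) (n : ℕ) :
    z * (1 - z) * aboveSum (2 * (n + 1)) z⁻¹ =
      aboveSum (2 * n) z⁻¹ - z * aboveSum (2 * n) 1 := by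
  have h := congrArg (coeff (n + 1)) (aboveSeries_mul_sub hz)
  rw [show aboveSeries z⁻¹ * (C z * (1 - C z) - X) =
      C (z * (1 - z)) * aboveSeries z⁻¹ - X * aboveSeries z⁻¹ by
        rw [map_mul, map_sub, map_one]; ring,
    show C z * (1 - C z - X * aboveSeries 1) = C (z * (1 - z)) - C z * (X * aboveSeries 1) by
        rw [map_mul, map_sub, map_one]; ring,
    map_sub, map_sub, coeff_C_mul, coeff_C_mul, coeff_succ_X_mul, coeff_succ_X_mul, coeff_C,
    if_neg (Nat.succ_ne_zero n)] at h
  simp only [aboveSeries, coeff_mk] at h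
  linarith

lemma transitSum_recurrence {z : ℝ} (hz : z ≠ 0) (n : ℕ) :
    z * (1 - z) * transitSum (2 * (n + 1)) z⁻¹ z⁻¹ =
      transitSum (2 * n) z⁻¹ z⁻¹ + z * (1 - 2 * z) * aboveSum (2 * (n + 1)) z⁻¹ := by
  have h := congrArg (coeff (n + 1)) (transitSeries_mul_sub hz)
  rw [show transitSeries z⁻¹ * (C z * (1 - C z) - X) =
      C (z * (1 - z)) * transitSeries z⁻¹ - X * transitSeries z⁻¹ by
        rw [map_mul, map_sub, map_one]; ring,
    show C z * C z + C z * (1 - 2 * C z) * aboveSeries z⁻¹ =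
      C (z * z) + C (z * (1 - 2 * z)) * aboveSeries z⁻¹ by
        rw [map_mul, map_mul, map_sub, map_one, map_mul, map_ofNat],
    map_sub, map_add, coeff_C_mul, coeff_C_mul, coeff_succ_X_mul, coeff_C,
    if_neg (Nat.succ_ne_zero n)] at h
  simp only [aboveSeries, transitSeries, coeff_mk] at h
  linarith

end GeneratingFunction

/-! ### Positivity and monotonicity -/

lemma aboveSum_nonneg (N : ℕ) {u : ℝ} (hu : 0 < u) : 0 ≤ aboveSum N u :=
  Finset.sum_nonneg fun w _ => by
    split_ifs
    exacts [(contactWeight_pos hu hu w).le, le_rfl]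

lemma aboveSum_mono (N : ℕ) {u u' : ℝ} (hu : 0 < u) (huu : u ≤ u') :
    aboveSum N u ≤ aboveSum N u' := by
  rw [← sum_isAbove N u u, ← sum_isAbove N u' u]
  refine Finset.sum_le_sum fun w _ => ?_
  split_ifs
  exacts [contactWeight_mono_left hu huu hu w, le_rfl]

lemma aboveSum_one_eq_catalan (n : ℕ) : aboveSum (2 * n) 1 = catalan n := by
  induction n using Nat.strong_induction_on with
  | _ n ih =>
    cases n with
    | zero => simp [aboveSum_zero]
    | succ n =>
      rw [aboveSum_even_succ, one_mul, catalan_succ, Nat.cast_sum, Finset.sum_range]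
      refine Finset.sum_congr rfl fun k _ => ?_
      rw [ih k (by omega), ih (n - k) (by omega), Nat.cast_mul]

lemma four_pow_le_aboveSum_one (n : ℕ) : (4 : ℝ) ^ n ≤ 2 * (n + 1) ^ 2 * aboveSum (2 * n) 1 := by
  have h1 : 4 ^ n ≤ 2 * (n + 1) * n.centralBinom := by
    rcases Nat.eq_zero_or_pos n with rfl | hn
    · simp
    · exact (Nat.four_pow_le_two_mul_self_mul_centralBinom n hn).trans
        (Nat.mul_le_mul_right _ (by omega))
  rw [← succ_mul_catalan_eq_centralBinom] at h1
  have h2 : (4 : ℝ) ^ n ≤ 2 * (n + 1) * ((n + 1) * catalan n) := by exact_mod_cast h1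
  rw [aboveSum_one_eq_catalan]
  linarith

/-- Only the walks made of a single arch are kept. -/
lemma mul_aboveSum_one_le (n : ℕ) {u : ℝ} (hu : 0 < u) :
    u * aboveSum (2 * n) 1 ≤ aboveSum (2 * (n + 1)) u := by
  rw [aboveSum_even_succ]
  refine mul_le_mul_of_nonneg_left ?_ hu.le
  have := Finset.single_le_sum (f := fun k => aboveSum (2 * k) u * aboveSum (2 * (n - k)) 1)
    (s := Finset.range (n + 1))
    (fun k _ => mul_nonneg (aboveSum_nonneg _ hu) (aboveSum_nonneg _ one_pos))
    (Finset.mem_range.2 n.succ_pos)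
  simpa [aboveSum_zero] using this

lemma aboveSum_left_le_transitSum (n : ℕ) {u v : ℝ} (hu : 0 < u) (hv : 0 < v) :
    aboveSum (2 * n) u ≤ transitSum (2 * n) u v := by
  rw [transitSum_even]
  have := Finset.single_le_sum (f := fun k => aboveSum (2 * k) u * aboveSum (2 * (n - k)) v)
    (s := Finset.range (n + 1))
    (fun k _ => mul_nonneg (aboveSum_nonneg _ hu) (aboveSum_nonneg _ hv))
    (Finset.mem_range.2 n.lt_succ_self)
  simpa [aboveSum_zero] using this

lemma aboveSum_right_le_transitSum (n : ℕ) {u v : ℝ} (hu : 0 < u) (hv : 0 < v) :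
    aboveSum (2 * n) v ≤ transitSum (2 * n) u v := by
  rw [transitSum_even]
  have := Finset.single_le_sum (f := fun k => aboveSum (2 * k) u * aboveSum (2 * (n - k)) v)
    (s := Finset.range (n + 1))
    (fun k _ => mul_nonneg (aboveSum_nonneg _ hu) (aboveSum_nonneg _ hv))
    (Finset.mem_range.2 n.succ_pos)
  simpa [aboveSum_zero] using this

lemma transitSum_zero (u v : ℝ) : transitSum 0 u v = 1 := by
  have := transitSum_even 0 u v
  simpa [aboveSum_zero] using this

lemma transitSum_symm (n : ℕ) (u v : ℝ) : transitSum (2 * n) u v = transitSum (2 * n) v u := by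
  rw [transitSum_even, transitSum_even, ← Finset.sum_range_reflect]
  refine Finset.sum_congr rfl fun k hk => ?_
  rw [Finset.mem_range] at hk
  rw [show n + 1 - 1 - k = n - k by omega, show n - (n - k) = k by omega, mul_comm]

/-! ### The renewal sequence -/

/-- The normalized generating polynomial of walks above the axis. -/
noncomputable def renewal (z : ℝ) (n : ℕ) : ℝ := aboveSum (2 * n) z⁻¹ * (z * (1 - z)) ^ n

lemma renewal_zero (z : ℝ) : renewal z 0 = 1 := by simp [renewal, aboveSum_zero]

lemma renewal_succ {z : ℝ} (hz : z ≠ 0) (n : ℕ) :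
    renewal z (n + 1) = renewal z n - z * (aboveSum (2 * n) 1 * (z * (1 - z)) ^ n) := by
  rw [renewal, renewal]
  linear_combination (z * (1 - z)) ^ n * aboveSum_recurrence hz n

lemma mul_one_sub_pos {z : ℝ} (h0 : 0 < z) (h1 : z ≤ 1 / 2) : 0 < z * (1 - z) :=
  mul_pos h0 (by linarith)

lemma renewal_nonneg {z : ℝ} (h0 : 0 < z) (h1 : z ≤ 1 / 2) (n : ℕ) : 0 ≤ renewal z n :=
  mul_nonneg (aboveSum_nonneg _ (inv_pos.2 h0)) (pow_nonneg (mul_one_sub_pos h0 h1).le _)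

lemma renewal_antitone {z : ℝ} (h0 : 0 < z) (h1 : z ≤ 1 / 2) : Antitone (renewal z) :=
  antitone_nat_of_succ_le fun n => by
    rw [renewal_succ h0.ne']
    have := mul_nonneg h0.le (mul_nonneg (aboveSum_nonneg (2 * n) one_pos)
      (pow_nonneg (mul_one_sub_pos h0 h1).le n))
    linarith

lemma renewal_le_one {z : ℝ} (h0 : 0 < z) (h1 : z ≤ 1 / 2) (n : ℕ) : renewal z n ≤ 1 := by
  simpa [renewal_zero] using renewal_antitone h0 h1 (Nat.zero_le n)

lemma renewal_eq {z : ℝ} (hz : z ≠ 0) (n : ℕ) :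
    renewal z n = 1 - z * ∑ k ∈ Finset.range n, aboveSum (2 * k) 1 * (z * (1 - z)) ^ k := by
  induction n with
  | zero => simp [renewal_zero]
  | succ n ih => rw [renewal_succ hz, ih, Finset.sum_range_succ]; ring

/-- Nonnegativity of the renewal sequence bounds the partial sums by $1/z$. -/
lemma summable_catalan {z : ℝ} (h0 : 0 < z) (h1 : z ≤ 1 / 2) :
    Summable fun n => aboveSum (2 * n) 1 * (z * (1 - z)) ^ n := by
  refine summable_of_sum_range_le (c := z⁻¹) (fun n => mul_nonneg (aboveSum_nonneg _ one_pos)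
    (pow_nonneg (mul_one_sub_pos h0 h1).le _)) fun n => ?_
  have h2 := renewal_nonneg h0 h1 n
  rw [renewal_eq h0.ne'] at h2
  rw [← one_div, le_div_iff₀' h0]
  linarith

lemma catalan_tsum_equation {z : ℝ} (h0 : 0 < z) (h1 : z ≤ 1 / 2) :
    ∑' n, aboveSum (2 * n) 1 * (z * (1 - z)) ^ n =
      1 + z * (1 - z) * (∑' n, aboveSum (2 * n) 1 * (z * (1 - z)) ^ n) ^ 2 := by
  have hs := summable_catalan h0 h1
  have hn : Summable fun n => ‖aboveSum (2 * n) 1 * (z * (1 - z)) ^ n‖ := hs.norm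
  rw [sq, tsum_mul_tsum_eq_tsum_sum_range_of_summable_norm hn hn, ← tsum_mul_left,
    hs.tsum_eq_zero_add]
  congr 1
  · simp [aboveSum_zero]
  · refine tsum_congr fun n => ?_
    rw [aboveSum_even_succ, one_mul, Finset.sum_mul, Finset.mul_sum]
    refine Finset.sum_congr rfl fun k hk => ?_
    rw [Finset.mem_range] at hk
    rw [show n + 1 = k + (n - k) + 1 by omega]
    ring

lemma catalan_tsum {z : ℝ} (h0 : 0 < z) (h1 : z ≤ 1 / 2) :
    ∑' n, aboveSum (2 * n) 1 * (z * (1 - z)) ^ n = (1 - z)⁻¹ := by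
  -- The quadratic equation leaves two candidates, $y$ and $1-y$, for $y(1-y)\,C(y(1-y))$.
  have hroot : ∀ y : ℝ, 0 < y → y ≤ 1 / 2 →
      y * (1 - y) * (∑' n, aboveSum (2 * n) 1 * (y * (1 - y)) ^ n) = y ∨
      y * (1 - y) * (∑' n, aboveSum (2 * n) 1 * (y * (1 - y)) ^ n) = 1 - y := by
    intro y hy0 hy1
    have h := catalan_tsum_equation hy0 hy1
    set c := ∑' n, aboveSum (2 * n) 1 * (y * (1 - y)) ^ n
    have : (y * (1 - y) * c - y) * (y * (1 - y) * c - (1 - y)) = 0 := by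
      linear_combination (-(y * (1 - y))) * h
    rcases mul_eq_zero.1 this with h | h
    · left; linarith
    · right; linarith
  have hhalf := hroot (1 / 2) (by norm_num) le_rfl
  have hle : z * (1 - z) * (∑' n, aboveSum (2 * n) 1 * (z * (1 - z)) ^ n) ≤
      1 / 2 * (1 - 1 / 2) * (∑' n, aboveSum (2 * n) 1 * (1 / 2 * (1 - 1 / 2)) ^ n) := by
    have ht : z * (1 - z) ≤ 1 / 2 * (1 - 1 / 2) := by nlinarith [sq_nonneg (z - 1 / 2)]
    have htp := mul_one_sub_pos h0 h1
    refine mul_le_mul ht ?_ (tsum_nonneg fun n => mul_nonneg (aboveSum_nonneg _ one_pos)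
      (pow_nonneg htp.le _)) (by norm_num)
    refine (summable_catalan h0 h1).tsum_le_tsum (fun n => ?_)
      (summable_catalan (by norm_num) le_rfl)
    exact mul_le_mul_of_nonneg_left (pow_le_pow_left₀ htp.le ht n) (aboveSum_nonneg _ one_pos)
  -- At $y=1/2$ the candidates coincide, so by monotonicity the value at $z$ is at most $1/2$; this
  -- selects $z$, the two roots being equal if $z=1/2$.
  have hz : z * (1 - z) * (∑' n, aboveSum (2 * n) 1 * (z * (1 - z)) ^ n) = z := by
    rcases hroot z h0 h1 with h | h
    · exact h
    · rcases hhalf with h' | h' <;> linarith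
  have h1z : 1 - z ≠ 0 := by linarith
  refine eq_inv_of_mul_eq_one_left (mul_left_cancel₀ h0.ne' ?_)
  linarith

lemma rho_eq {z : ℝ} (h1 : z ≤ 1 / 2) : rho z = 1 - z * (1 - z)⁻¹ := by
  have h1z : 1 - z ≠ 0 := by linarith
  rw [rho]
  field_simp
  ring

lemma renewal_tendsto {z : ℝ} (h0 : 0 < z) (h1 : z ≤ 1 / 2) :
    Tendsto (renewal z) atTop (𝓝 (rho z)) := by
  have h := ((summable_catalan h0 h1).hasSum.tendsto_sum_nat.const_mul z).const_sub 1
  rw [catalan_tsum h0 h1, ← rho_eq h1] at h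
  exact h.congr fun n => (renewal_eq h0.ne' n).symm

lemma rho_le_renewal {z : ℝ} (h0 : 0 < z) (h1 : z ≤ 1 / 2) (n : ℕ) : rho z ≤ renewal z n :=
  (renewal_antitone h0 h1).le_of_tendsto (renewal_tendsto h0 h1) n

lemma rho_pos {z : ℝ} (h : z < 1 / 2) : 0 < rho z := div_pos (by linarith) (by linarith)

lemma rho_half : rho (1 / 2) = 0 := by norm_num [rho]

/-! ### The partition function on the coexistence line -/

/-- The normalized partition function on the coexistence line. -/
noncomputable def coexistence (z : ℝ) (n : ℕ) : ℝ :=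
  transitSum (2 * n) z⁻¹ z⁻¹ * (z * (1 - z)) ^ n

/-- The recurrence for $T_n$ with $z(1-2z)=\rho(z)\,z(1-z)$, each side normalised by powers of
$z(1-z)$. -/
lemma coexistence_succ {z : ℝ} (h0 : 0 < z) (h1 : z ≤ 1 / 2) (n : ℕ) :
    coexistence z (n + 1) = coexistence z n + rho z * renewal z (n + 1) := by
  have h1z : 1 - z ≠ 0 := by linarith
  have h := transitSum_recurrence h0.ne' n
  have hr : z * (1 - 2 * z) = rho z * (z * (1 - z)) := by rw [rho]; field_simp
  rw [hr] at h
  rw [coexistence, coexistence, renewal]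
  linear_combination (z * (1 - z)) ^ n * h

lemma coexistence_eq {z : ℝ} (h0 : 0 < z) (h1 : z ≤ 1 / 2) (n : ℕ) :
    coexistence z n = 1 + rho z * ∑ k ∈ Finset.range n, renewal z (k + 1) := by
  induction n with
  | zero => simp [coexistence, transitSum_zero]
  | succ n ih => rw [coexistence_succ h0 h1, ih, Finset.sum_range_succ]; ring

lemma coexistence_half (n : ℕ) : coexistence (1 / 2) n = 1 := by
  rw [coexistence_eq (by norm_num) le_rfl, rho_half, zero_mul, add_zero]

lemma coexistence_div_tendsto {z : ℝ} (h0 : 0 < z) (h1 : z ≤ 1 / 2) :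
    Tendsto (fun n : ℕ => coexistence z n / n) atTop (𝓝 (rho z ^ 2)) := by
  have h2 := ((tendsto_add_atTop_iff_nat 1).2 (renewal_tendsto h0 h1)).cesaro
  have h3 := (tendsto_inv_atTop_nhds_zero_nat (𝕜 := ℝ)).add (h2.const_mul (rho z))
  rw [zero_add, ← sq] at h3
  refine h3.congr fun n => ?_
  rw [coexistence_eq h0 h1]
  ring

end OTW

namespace OTW

/-! ### Averages in terms of contact weights -/

lemma prod_range_odd {f : ℕ → ℝ} (hf : ∀ k, k % 2 = 0 → f k = 1) (n : ℕ) :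
    ∏ k ∈ Finset.range (2 * n), f k = ∏ i ∈ Finset.Icc 1 n, f (2 * i - 1) := by
  induction n with
  | zero => simp
  | succ n ih =>
    rw [show 2 * (n + 1) = 2 * n + 1 + 1 by ring, Finset.prod_range_succ, Finset.prod_range_succ,
      ih, Finset.prod_Icc_succ_top (by omega), hf (2 * n) (by omega), mul_one]
    rfl

lemma sum_Icc_eq_sum_range (f : ℕ → ℝ) (n : ℕ) :
    ∑ i ∈ Finset.Icc 1 n, f i = ∑ i ∈ Finset.range (n + 1), f i - f 0 := by
  induction n with
  | zero => simp
  | succ n ih => rw [Finset.sum_Icc_succ_top (by omega), ih, Finset.sum_range_succ _ (n + 1)]; ring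

lemma contactAbove_iff {N : ℕ} (w : Fin N → Bool) {i : ℕ} (hi : 1 ≤ i) :
    ContactAbove w i ↔ height w (2 * i - 1) = 1 ∧ height w (2 * i - 1 + 1) = 0 := by
  constructor
  · rintro ⟨k, hk, h⟩
    rwa [show 2 * i - 1 = k by omega]
  · exact fun h => ⟨2 * i - 1, by omega, h⟩

lemma contactAbove_not {N : ℕ} (w : Fin N → Bool) (i : ℕ) :
    ContactAbove (fun j => !w j) i ↔ ContactBelow w i := by
  simp [ContactAbove, ContactBelow, height_not, neg_eq_iff_eq_neg]

lemma contactWeight_mul_exp_left {n : ℕ} (u v h : ℝ) (w : Fin (2 * n) → Bool) :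
    contactWeight (u * Real.exp h) v w = contactWeight u v w * Real.exp (h * aHat w) := by
  classical
  have h1 : contactWeight (u * Real.exp h) v w = contactWeight u v w *
      ∏ k ∈ Finset.range (2 * n),
        if height w k = 1 ∧ height w (k + 1) = 0 then Real.exp h else 1 := by
    rw [contactWeight, contactWeight, ← Finset.prod_mul_distrib]
    refine Finset.prod_congr rfl fun k _ => ?_
    split_ifs <;> ring
  -- By parity a contact can only be the step from time $2i-1$ to $2i$, so even starting times
  -- contribute $1$.
  have h2 : ∏ k ∈ Finset.range (2 * n),
      (if height w k = 1 ∧ height w (k + 1) = 0 then Real.exp h else 1) =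
      ∏ k ∈ Finset.range (2 * n), if k % 2 = 0 then 1 else
        if height w k = 1 ∧ height w (k + 1) = 0 then Real.exp h else 1 := by
    refine Finset.prod_congr rfl fun k hk => ?_
    have := height_parity w (Finset.mem_range.1 hk).le
    by_cases hk0 : k % 2 = 0
    · rw [if_pos hk0, if_neg]
      rintro ⟨h3, -⟩
      rw [h3] at this
      omega
    · rw [if_neg hk0]
  rw [h1, h2, prod_range_odd (fun k hk => if_pos hk), aHat, Finset.mul_sum, Real.exp_sum]
  congr 1
  refine Finset.prod_congr rfl fun i hi => ?_
  rw [Finset.mem_Icc] at hi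
  rw [if_neg (by omega), aHatAt]
  by_cases hc : ContactAbove w i
  · rw [if_pos hc, if_pos ((contactAbove_iff w hi.1).1 hc), mul_one]
  · rw [if_neg hc, if_neg fun h' => hc ((contactAbove_iff w hi.1).2 h'), mul_zero, Real.exp_zero]

lemma contactWeight_mul_exp_right {n : ℕ} (u v h : ℝ) (w : Fin (2 * n) → Bool) :
    contactWeight u (v * Real.exp h) w = contactWeight u v w * Real.exp (h * bHat w) := by
  rw [← contactWeight_not, contactWeight_mul_exp_left, contactWeight_not]
  have : ∀ i, aHatAt i (fun j => !w j) = bHatAt i w := fun i => by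
    classical exact if_congr (contactAbove_not w i) rfl rfl
  simp only [aHat, bHat, this]

/-- The walk has $n$ up and $n$ down steps; the factor missing at each return to the axis is
restored and compensated by $1/z_1$ (return from above) or $1/z_2$ (from below). -/
lemma weight_eq {n : ℕ} {z₁ z₂ : ℝ} (h₁ : z₁ ≠ 0) (h₂ : z₂ ≠ 0) {w : Fin (2 * n) → Bool}
    (hw : height w (2 * n) = 0) :
    weight z₁ z₂ w = (z₁ * z₂) ^ n * contactWeight z₁⁻¹ z₂⁻¹ w := by
  have hstep : ∀ j : Fin (2 * n),
      (if height w ((j : ℕ) + 1) = 0 then 1 else if w j then z₂ else z₁) =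
      (if w j then z₂ else z₁) * ((if height w j = 1 ∧ height w (j + 1) = 0 then z₁⁻¹ else 1) *
        (if height w j = -1 ∧ height w (j + 1) = 0 then z₂⁻¹ else 1)) := by
    intro j
    have h := height_succ w j
    by_cases h0 : height w ((j : ℕ) + 1) = 0
    · by_cases hj : w j = true
      · have h3 : height w j = -1 := by rw [h0, if_pos hj] at h; omega
        simp [h0, hj, h3, h₂]
      · have h3 : height w j = 1 := by rw [h0, if_neg hj] at h; omega
        simp [h0, hj, h3, h₁]
    · simp [h0]
  have hcard : (Finset.univ.filter fun j : Fin (2 * n) => w j = true).card = n ∧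
      (Finset.univ.filter fun j : Fin (2 * n) => ¬ w j = true).card = n := by
    have h1 := Finset.card_filter_add_card_filter_not (s := Finset.univ)
      (fun j : Fin (2 * n) => w j = true)
    rw [Finset.card_univ, Fintype.card_fin] at h1
    have h2 : height w (2 * n) = ∑ j : Fin (2 * n), if w j = true then (1 : ℤ) else -1 :=
      Finset.sum_congr rfl fun j _ => if_pos j.2
    rw [hw, Finset.sum_ite, Finset.sum_const, Finset.sum_const] at h2
    simp only [nsmul_eq_mul, mul_one, mul_neg] at h2
    omega
  rw [weight, Finset.prod_congr rfl fun j _ => hstep j, Finset.prod_mul_distrib, Finset.prod_ite,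
    Finset.prod_const, Finset.prod_const, hcard.1, hcard.2, contactWeight, Finset.prod_range,
    mul_comm z₁ z₂, mul_pow]

open Classical in
lemma sum_walks_eq (n : ℕ) {z₁ z₂ : ℝ} (h₁ : z₁ ≠ 0) (h₂ : z₂ ≠ 0)
    (f : (Fin (2 * n) → Bool) → ℝ) :
    ∑ w ∈ walks n, weight z₁ z₂ w * f w = (z₁ * z₂) ^ n *
      ∑ w : Fin (2 * n) → Bool,
        if IsTransit w then contactWeight z₁⁻¹ z₂⁻¹ w * f w else 0 := by
  rw [walks, Finset.sum_filter, Finset.mul_sum]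
  refine Finset.sum_congr rfl fun w _ => ?_
  by_cases h : IsTransit w
  · rw [if_pos h, if_pos (show IsOneTransit w from h), weight_eq h₁ h₂ h.1, mul_assoc]
  · rw [if_neg h, if_neg (show ¬ IsOneTransit w from h), mul_zero]

lemma partitionFunction_eq (n : ℕ) {z₁ z₂ : ℝ} (h₁ : z₁ ≠ 0) (h₂ : z₂ ≠ 0) :
    partitionFunction n z₁ z₂ = (z₁ * z₂) ^ n * transitSum (2 * n) z₁⁻¹ z₂⁻¹ := by
  have := sum_walks_eq n h₁ h₂ fun _ => 1
  simpa [partitionFunction, transitSum] using this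

open Classical in
lemma mean_eq (n : ℕ) {z₁ z₂ : ℝ} (h₁ : z₁ ≠ 0) (h₂ : z₂ ≠ 0) (f : (Fin (2 * n) → Bool) → ℝ) :
    mean n z₁ z₂ f = (∑ w : Fin (2 * n) → Bool,
      if IsTransit w then contactWeight z₁⁻¹ z₂⁻¹ w * f w else 0) /
        transitSum (2 * n) z₁⁻¹ z₂⁻¹ := by
  rw [mean, sum_walks_eq n h₁ h₂, partitionFunction_eq n h₁ h₂,
    mul_div_mul_left _ _ (pow_ne_zero _ (mul_ne_zero h₁ h₂))]

lemma mean_aHatAt {n i : ℕ} (hi : 1 ≤ i) (hin : i ≤ n) {z₁ z₂ : ℝ} (h₁ : z₁ ≠ 0) (h₂ : z₂ ≠ 0) :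
    mean n z₁ z₂ (aHatAt i) = aboveSum (2 * i) z₁⁻¹ * transitSum (2 * (n - i)) z₁⁻¹ z₂⁻¹ /
      transitSum (2 * n) z₁⁻¹ z₂⁻¹ := by
  classical
  rw [mean_eq n h₁ h₂, Nat.mul_sub, ← sum_contactAbove hi (by omega)]
  congr 1
  refine Finset.sum_congr rfl fun w _ => ?_
  simp only [aHatAt, mul_ite, mul_one, mul_zero, ite_and]

lemma mean_bHatAt {n i : ℕ} (hi : 1 ≤ i) (hin : i ≤ n) {z₁ z₂ : ℝ} (h₁ : z₁ ≠ 0) (h₂ : z₂ ≠ 0) :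
    mean n z₁ z₂ (bHatAt i) = (transitSum (2 * i) z₁⁻¹ z₂⁻¹ - aboveSum (2 * i) z₁⁻¹) *
      aboveSum (2 * (n - i)) z₂⁻¹ / transitSum (2 * n) z₁⁻¹ z₂⁻¹ := by
  classical
  rw [mean_eq n h₁ h₂, Nat.mul_sub, ← sum_contactBelow hi (by omega)]
  congr 1
  refine Finset.sum_congr rfl fun w _ => ?_
  simp only [bHatAt, mul_ite, mul_one, mul_zero, ite_and]

lemma mean_sum (n : ℕ) (z₁ z₂ : ℝ) (s : Finset ℕ) (f : ℕ → (Fin (2 * n) → Bool) → ℝ) :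
    mean n z₁ z₂ (fun w => ∑ i ∈ s, f i w) = ∑ i ∈ s, mean n z₁ z₂ (f i) := by
  simp only [mean, ← Finset.sum_div, Finset.mul_sum]
  rw [Finset.sum_comm]

lemma mean_add (n : ℕ) (z₁ z₂ : ℝ) (f g : (Fin (2 * n) → Bool) → ℝ) :
    mean n z₁ z₂ (fun w => f w + g w) = mean n z₁ z₂ f + mean n z₁ z₂ g := by
  simp only [mean, ← add_div, mul_add, Finset.sum_add_distrib]

/-- On the coexistence line, contacts above and below the axis are equally many on average. -/
lemma mean_aHat_eq_mean_bHat (n : ℕ) {z : ℝ} (hz : z ≠ 0) :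
    mean n z z aHat = mean n z z bHat := by
  have ha : mean n z z aHat = ∑ i ∈ Finset.Icc 1 n, mean n z z (aHatAt i) := mean_sum ..
  have hb : mean n z z bHat = ∑ i ∈ Finset.Icc 1 n, mean n z z (bHatAt i) := mean_sum ..
  rw [ha, hb,
    Finset.sum_congr rfl fun i hi =>
      mean_aHatAt (Finset.mem_Icc.1 hi).1 (Finset.mem_Icc.1 hi).2 hz hz,
    Finset.sum_congr rfl fun i hi =>
      mean_bHatAt (Finset.mem_Icc.1 hi).1 (Finset.mem_Icc.1 hi).2 hz hz,
    ← Finset.sum_div, ← Finset.sum_div, sum_Icc_eq_sum_range, sum_Icc_eq_sum_range]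
  congr 1
  -- Both sums become the full convolution of $A$ with $T$ minus $T_n$: above, the term $i=0$ is
  -- removed; below, it vanishes and $\sum_i A_iA_{n-i}=T_n$ is subtracted.
  simp only [sub_mul, Finset.sum_sub_distrib, mul_zero, Nat.sub_zero, aboveSum_zero,
    transitSum_zero, ← transitSum_even, one_mul, sub_self]
  rw [zero_mul, sub_zero]
  congr 1
  rw [← Finset.sum_range_reflect]
  refine Finset.sum_congr rfl fun k hk => ?_
  rw [Finset.mem_range] at hk
  rw [show n + 1 - 1 - k = n - k by omega, show n - (n - k) = k by omega, mul_comm]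

/-! ### Convexity -/

/-- Jensen's inequality for the exponential. -/
lemma mul_mean_le_log_sub_log {ι : Type*} {s : Finset ι} {c f : ι → ℝ} (hs : s.Nonempty)
    (hc : ∀ i ∈ s, 0 < c i) (h : ℝ) :
    h * ((∑ i ∈ s, c i * f i) / ∑ i ∈ s, c i) ≤
      Real.log (∑ i ∈ s, c i * Real.exp (h * f i)) - Real.log (∑ i ∈ s, c i) := by
  have hpos : 0 < ∑ i ∈ s, c i := Finset.sum_pos hc hs
  have hpos' : 0 < ∑ i ∈ s, c i * Real.exp (h * f i) :=
    Finset.sum_pos (fun i hi => mul_pos (hc i hi) (Real.exp_pos _)) hs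
  have hJ := convexOn_exp.map_centerMass_le (t := s) (w := c) (p := fun i => h * f i)
    (fun i hi => (hc i hi).le) hpos (fun i _ => Set.mem_univ _)
  simp only [Finset.centerMass, smul_eq_mul, Function.comp_apply] at hJ
  rw [← Real.log_div hpos'.ne' hpos.ne', Real.le_log_iff_exp_le (div_pos hpos' hpos)]
  refine le_trans (le_of_eq ?_) (hJ.trans (le_of_eq ?_))
  · congr 1
    rw [mul_div_assoc', Finset.mul_sum, div_eq_inv_mul]
    congr 1
    exact Finset.sum_congr rfl fun i _ => by ring
  · rw [div_eq_inv_mul]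

/-- Griffiths' argument: dividing the chord inequality by $h<0$ bounds the means below, by $h>0$
above, and both limiting slopes are close to $d$ for small $h$. -/
lemma tendsto_of_mul_le_sub {L : ℕ → ℝ} {G : ℕ → ℝ → ℝ} {g : ℝ → ℝ} {d : ℝ}
    (hG : ∀ h, Tendsto (fun n => G n h) atTop (𝓝 (g h)))
    (hL : ∀ n h, h * L n ≤ G n h - G n 0) (hg : HasDerivAt g d 0) :
    Tendsto L atTop (𝓝 d) := by
  have hslope := hasDerivAt_iff_tendsto_slope_zero.1 hg
  simp only [zero_add, smul_eq_mul] at hslope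
  rw [tendsto_order]
  constructor
  · intro a ha
    have h1 := (hslope.eventually (lt_mem_nhds ha)).filter_mono (nhdsLT_le_nhdsNE 0)
    obtain ⟨h, h2, h3⟩ := (h1.and self_mem_nhdsWithin).exists
    have h4 := (((hG h).sub (hG 0)).const_mul h⁻¹).eventually (lt_mem_nhds h2)
    filter_upwards [h4] with n hn
    refine hn.trans_le ?_
    have h3' : h < 0 := h3
    rw [← div_eq_inv_mul, div_le_iff_of_neg h3', mul_comm]
    exact hL n h
  · intro a ha
    have h1 := (hslope.eventually (gt_mem_nhds ha)).filter_mono (nhdsGT_le_nhdsNE 0)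
    obtain ⟨h, h2, h3⟩ := (h1.and self_mem_nhdsWithin).exists
    have h4 := (((hG h).sub (hG 0)).const_mul h⁻¹).eventually (gt_mem_nhds h2)
    filter_upwards [h4] with n hn
    refine lt_of_le_of_lt ?_ hn
    have h3' : 0 < h := h3
    rw [← div_eq_inv_mul, le_div_iff₀ h3', mul_comm]
    exact hL n h

/-- The thermal average of an observable conjugate to a change of the contact weights. -/
lemma mul_mean_le {n : ℕ} {z₁ z₂ u' v' h : ℝ} (h₁ : 0 < z₁) (h₂ : 0 < z₂)
    {f : (Fin (2 * n) → Bool) → ℝ}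
    (hf : ∀ w, contactWeight u' v' w = contactWeight z₁⁻¹ z₂⁻¹ w * Real.exp (h * f w)) :
    h * mean n z₁ z₂ f ≤
      Real.log (transitSum (2 * n) u' v') - Real.log (transitSum (2 * n) z₁⁻¹ z₂⁻¹) := by
  classical
  -- Nonemptiness is read off from the positive lower bound on Catalan numbers.
  have hne : (Finset.univ.filter fun w : Fin (2 * n) → Bool => IsTransit w).Nonempty := by
    by_contra hempty
    rw [Finset.not_nonempty_iff_eq_empty] at hempty
    have h0 : transitSum (2 * n) 1 1 = 0 := by
      rw [transitSum, ← Finset.sum_filter, hempty, Finset.sum_empty]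
    have h1 := aboveSum_left_le_transitSum n one_pos one_pos
    have h2 := four_pow_le_aboveSum_one n
    have h3 : (0 : ℝ) < 4 ^ n := by positivity
    have h4 : 2 * ((n : ℝ) + 1) ^ 2 * aboveSum (2 * n) 1 ≤ 0 :=
      mul_nonpos_of_nonneg_of_nonpos (by positivity) (h1.trans h0.le)
    linarith
  have := mul_mean_le_log_sub_log (f := f) hne
    (fun w _ => contactWeight_pos (inv_pos.2 h₁) (inv_pos.2 h₂) w) h
  rw [mean_eq n h₁.ne' h₂.ne', transitSum, transitSum, ← Finset.sum_filter, ← Finset.sum_filter,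
    ← Finset.sum_filter]
  simpa only [hf] using this

/-! ### The free energy -/

/-- The exponential growth rate of the walks above the axis. -/
noncomputable def growth (z : ℝ) : ℝ := (min z (1 / 2) * (1 - min z (1 / 2)))⁻¹

lemma growth_of_le {z : ℝ} (h : z ≤ 1 / 2) : growth z = (z * (1 - z))⁻¹ := by
  rw [growth, min_eq_left h]

lemma growth_of_ge {z : ℝ} (h : 1 / 2 ≤ z) : growth z = 4 := by
  rw [growth, min_eq_right h]; norm_num

lemma growth_pos {z : ℝ} (h : 0 < z) : 0 < growth z :=
  inv_pos.2 (mul_one_sub_pos (lt_min h (by norm_num)) (min_le_right _ _))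

lemma growth_strictAnti {z z' : ℝ} (h0 : 0 < z) (hz : z < 1 / 2) (h : z < z') :
    growth z' < growth z := by
  have h1 : z < min z' (1 / 2) := lt_min h hz
  have h2 : min z' (1 / 2) ≤ 1 / 2 := min_le_right _ _
  rw [growth_of_le hz.le, growth]
  refine inv_strictAnti₀ (mul_one_sub_pos h0 hz.le) ?_
  nlinarith

lemma four_le_growth {z : ℝ} (h : 0 < z) : 4 ≤ growth z := by
  rcases le_total z (1 / 2) with h1 | h1
  · rw [growth_of_le h1, le_inv_comm₀ (by norm_num) (mul_one_sub_pos h h1)]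
    nlinarith [sq_nonneg (z - 1 / 2)]
  · rw [growth_of_ge h1]

lemma aboveSum_eq_renewal {z : ℝ} (h0 : 0 < z) (h1 : z ≤ 1 / 2) (n : ℕ) :
    aboveSum (2 * n) z⁻¹ = renewal z n * growth z ^ n := by
  have := mul_one_sub_pos h0 h1
  rw [renewal, growth_of_le h1, mul_assoc, ← mul_pow, mul_inv_cancel₀ this.ne', one_pow, mul_one]

lemma aboveSum_le_growth_pow {z : ℝ} (h0 : 0 < z) (n : ℕ) :
    aboveSum (2 * n) z⁻¹ ≤ growth z ^ n := by
  have key : ∀ y : ℝ, 0 < y → y ≤ 1 / 2 → aboveSum (2 * n) y⁻¹ ≤ growth y ^ n := by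
    intro y hy0 hy1
    rw [aboveSum_eq_renewal hy0 hy1]
    exact mul_le_of_le_one_left (pow_nonneg (growth_pos hy0).le _) (renewal_le_one hy0 hy1 n)
  rcases le_total z (1 / 2) with h1 | h1
  · exact key z h0 h1
  · have h2 := key (1 / 2) (by norm_num) le_rfl
    rw [growth_of_ge le_rfl] at h2
    rw [growth_of_ge h1]
    -- For $z\ge1/2$ the contact weight is at most $2$, the critical value, whose growth rate is
    -- already $4$.
    exact (aboveSum_mono _ (inv_pos.2 h0) (inv_anti₀ (by norm_num) h1)).trans h2

lemma exists_le_aboveSum {z : ℝ} (h0 : 0 < z) :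
    ∃ c > 0, ∀ n : ℕ, c * growth z ^ n / ((n : ℝ) + 1) ^ 2 ≤ aboveSum (2 * n) z⁻¹ := by
  have hg := growth_pos h0
  rcases lt_or_ge z (1 / 2) with h1 | h1
  · refine ⟨rho z, rho_pos h1, fun n => ?_⟩
    rw [aboveSum_eq_renewal h0 h1.le]
    refine (div_le_self (mul_nonneg (rho_pos h1).le (pow_nonneg hg.le _)) ?_).trans
      (mul_le_mul_of_nonneg_right (rho_le_renewal h0 h1.le n) (pow_nonneg hg.le _))
    exact one_le_pow₀ (by linarith [n.cast_nonneg (α := ℝ)])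
  · have hu : 0 < z⁻¹ := inv_pos.2 h0
    have hu2 : z⁻¹ ≤ 2 := by rw [inv_le_comm₀ h0 (by norm_num)]; linarith
    -- The $8$ combines the $2$ of the Catalan bound with the $4$ from shifting $n$ to $n+1$;
    -- $z^{-1}\le2$ settles $n=0$.
    refine ⟨z⁻¹ / 8, by positivity, fun n => ?_⟩
    rw [growth_of_ge h1]
    cases n with
    | zero => simp [aboveSum_zero]; linarith
    | succ n =>
      refine le_trans ?_ (mul_aboveSum_one_le n hu)
      have h2 := four_pow_le_aboveSum_one n
      have h3 := aboveSum_nonneg (2 * n) one_pos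
      rw [div_le_iff₀ (by positivity), pow_succ]
      push_cast
      have h4 : ((n : ℝ) + 1) ^ 2 * aboveSum (2 * n) 1 ≤
          ((n : ℝ) + 1 + 1) ^ 2 * aboveSum (2 * n) 1 :=
        mul_le_mul_of_nonneg_right (pow_le_pow_left₀ (by positivity) (by linarith) 2) h3
      have h5 := mul_le_mul_of_nonneg_left h2 hu.le
      have h6 := mul_le_mul_of_nonneg_left h4 hu.le
      linarith

lemma log_add_one_div_tendsto :
    Tendsto (fun n : ℕ => Real.log ((n : ℝ) + 1) / n) atTop (𝓝 0) := by
  have h1 : Tendsto (fun x : ℝ => Real.log x / x) atTop (𝓝 0) := by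
    simpa using Real.tendsto_pow_log_div_mul_add_atTop 1 0 1 one_ne_zero
  have h2 : Tendsto (fun n : ℕ => ((n : ℝ) + 1)) atTop atTop :=
    tendsto_atTop_add_const_right _ _ tendsto_natCast_atTop_atTop
  have h3 := (h1.comp h2).mul ((tendsto_inv_atTop_nhds_zero_nat (𝕜 := ℝ)).const_add 1)
  rw [zero_mul] at h3
  refine h3.congr' ?_
  filter_upwards [eventually_gt_atTop 0] with n hn
  have hn' : (0 : ℝ) < n := by exact_mod_cast hn
  simp only [Function.comp_apply]
  field_simp

/-- The convolution is at most $n+1$ terms of size $M^n$, and at least its end term with the larger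
growth rate. Polynomial factors vanish in the limit. -/
lemma free_energy_tendsto {z₁ z₂ : ℝ} (h₁ : 0 < z₁) (h₂ : 0 < z₂) :
    Tendsto (fun n : ℕ => Real.log (transitSum (2 * n) z₁⁻¹ z₂⁻¹) / n) atTop
      (𝓝 (Real.log (max (growth z₁) (growth z₂)))) := by
  set M := max (growth z₁) (growth z₂) with hM
  have hMpos : 0 < M := lt_max_of_lt_left (growth_pos h₁)
  obtain ⟨c, hc, hlow⟩ : ∃ c > 0, ∀ n : ℕ,
      c * M ^ n / ((n : ℝ) + 1) ^ 2 ≤ transitSum (2 * n) z₁⁻¹ z₂⁻¹ := by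
    rcases max_choice (growth z₁) (growth z₂) with h | h
    · obtain ⟨c, hc, hl⟩ := exists_le_aboveSum h₁
      rw [← h] at hl
      exact ⟨c, hc, fun n => (hl n).trans
        (aboveSum_left_le_transitSum n (inv_pos.2 h₁) (inv_pos.2 h₂))⟩
    · obtain ⟨c, hc, hl⟩ := exists_le_aboveSum h₂
      rw [← h] at hl
      exact ⟨c, hc, fun n => (hl n).trans
        (aboveSum_right_le_transitSum n (inv_pos.2 h₁) (inv_pos.2 h₂))⟩
  have hup : ∀ n : ℕ, transitSum (2 * n) z₁⁻¹ z₂⁻¹ ≤ ((n : ℝ) + 1) * M ^ n := by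
    intro n
    rw [transitSum_even]
    refine (Finset.sum_le_card_nsmul _ _ (M ^ n) fun k hk => ?_).trans (by simp)
    rw [Finset.mem_range] at hk
    have e : M ^ n = M ^ k * M ^ (n - k) := by rw [← pow_add]; congr 1; omega
    rw [e]
    refine mul_le_mul ?_ ?_ (aboveSum_nonneg _ (inv_pos.2 h₂)) (by positivity)
    · exact (aboveSum_le_growth_pow h₁ k).trans
        (pow_le_pow_left₀ (growth_pos h₁).le (le_max_left _ _) _)
    · exact (aboveSum_le_growth_pow h₂ _).trans
        (pow_le_pow_left₀ (growth_pos h₂).le (le_max_right _ _) _)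
  have hlog := log_add_one_div_tendsto
  have hinv := tendsto_inv_atTop_nhds_zero_nat (𝕜 := ℝ)
  have hl : Tendsto (fun n : ℕ => Real.log M + Real.log c * (n : ℝ)⁻¹ -
      2 * (Real.log ((n : ℝ) + 1) / n)) atTop (𝓝 (Real.log M)) := by
    have := ((hinv.const_mul (Real.log c)).const_add (Real.log M)).sub (hlog.const_mul 2)
    simpa using this
  have hu : Tendsto (fun n : ℕ => Real.log M + Real.log ((n : ℝ) + 1) / n) atTop
      (𝓝 (Real.log M)) := by
    simpa using hlog.const_add (Real.log M)
  refine tendsto_of_tendsto_of_tendsto_of_le_of_le' hl hu ?_ ?_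
  · filter_upwards [eventually_gt_atTop 0] with n hn
    have hn' : (0 : ℝ) < n := by exact_mod_cast hn
    have hlo := Real.log_le_log (by positivity) (hlow n)
    rw [Real.log_div (by positivity) (by positivity), Real.log_mul hc.ne' (by positivity),
      Real.log_pow, Real.log_pow] at hlo
    rw [le_div_iff₀ hn']
    push_cast at hlo
    refine le_trans (le_of_eq ?_) hlo
    field_simp
    ring
  · filter_upwards [eventually_gt_atTop 0] with n hn
    have hn' : (0 : ℝ) < n := by exact_mod_cast hn
    have hpos : 0 < transitSum (2 * n) z₁⁻¹ z₂⁻¹ := lt_of_lt_of_le (by positivity) (hlow n)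
    have hlo := Real.log_le_log hpos (hup n)
    rw [Real.log_mul (by positivity) (by positivity), Real.log_pow] at hlo
    rw [div_le_iff₀ hn']
    refine hlo.trans (le_of_eq ?_)
    field_simp
    ring

lemma hasDerivAt_log_inv {z : ℝ} (h0 : 0 < z) (h1 : z ≤ 1 / 2) :
    HasDerivAt (fun h => Real.log (z * Real.exp (-h) * (1 - z * Real.exp (-h)))⁻¹) (rho z) 0 := by
  have hz := mul_one_sub_pos h0 h1
  have e : HasDerivAt (fun h : ℝ => z * Real.exp (-h)) (-z) 0 := by
    have := ((hasDerivAt_neg (0 : ℝ)).exp).const_mul z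
    simpa using this
  have e2 := (e.mul (e.const_sub 1))
  have e3 := (e2.log (by simpa using hz.ne')).neg
  simp only [Real.log_inv]
  refine e3.congr_deriv ?_
  have h1z : 1 - z ≠ 0 := by linarith
  have h0z := h0.ne'
  simp only [neg_zero, Real.exp_zero, mul_one, Pi.mul_apply, rho]
  field_simp
  ring

lemma tendsto_mul_exp_neg (z : ℝ) : Tendsto (fun h => z * Real.exp (-h)) (𝓝 0) (𝓝 z) := by
  have : Continuous fun h : ℝ => z * Real.exp (-h) := by fun_prop
  simpa using this.tendsto 0

lemma hasDerivAt_log_growth_of_lt {z : ℝ} (h0 : 0 < z) (h1 : z < 1 / 2) :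
    HasDerivAt (fun h => Real.log (growth (z * Real.exp (-h)))) (rho z) 0 := by
  refine (hasDerivAt_log_inv h0 h1.le).congr_of_eventuallyEq ?_
  filter_upwards [(tendsto_mul_exp_neg z).eventually (gt_mem_nhds h1)] with h hh
  rw [growth_of_le hh.le]

/-- At $z=1/2$ the formula changes, but the function lies between $\log4$ and the smooth branch
$-\log(y(1-y))$, which agree at $h=0$ and both have derivative $0$ there since $\rho(1/2)=0$. Beyond
$1/2$ it is locally constant. -/
lemma hasDerivAt_log_growth_of_ge {z : ℝ} (h1 : 1 / 2 ≤ z) :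
    HasDerivAt (fun h => Real.log (growth (z * Real.exp (-h)))) 0 0 := by
  rcases h1.eq_or_lt with rfl | h1
  · have h2 := hasDerivAt_log_inv (z := 1 / 2) (by norm_num) le_rfl
    rw [rho_half] at h2
    rw [hasDerivAt_iff_isLittleO] at h2 ⊢
    refine (Asymptotics.IsBigO.of_bound 1 ?_).trans_isLittleO h2
    filter_upwards [(tendsto_mul_exp_neg (1 / 2)).eventually
      (gt_mem_nhds (show (1 / 2 : ℝ) < 1 by norm_num))] with h hh
    set y := 1 / 2 * Real.exp (-h) with hy
    have hy0 : 0 < y := by positivity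
    have hy' : 0 < y * (1 - y) := mul_pos hy0 (by linarith)
    have h4 : Real.log 4 ≤ Real.log (growth y) := Real.log_le_log (by norm_num) (four_le_growth hy0)
    have h5 : Real.log (growth y) ≤ Real.log (y * (1 - y))⁻¹ := by
      refine Real.log_le_log (growth_pos hy0) ?_
      rcases le_total y (1 / 2) with h | h
      · rw [growth_of_le h]
      · rw [growth_of_ge h, le_inv_comm₀ (by norm_num) hy']
        nlinarith [sq_nonneg (y - 1 / 2)]
    have e1 : growth (1 / 2 * Real.exp (-0)) = 4 := by
      rw [neg_zero, Real.exp_zero, mul_one, growth_of_ge le_rfl]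
    have e2 : (1 / 2 * Real.exp (-0) * (1 - 1 / 2 * Real.exp (-0)))⁻¹ = 4 := by
      rw [neg_zero, Real.exp_zero]; norm_num
    rw [e1, e2, smul_zero, sub_zero, sub_zero, one_mul, Real.norm_eq_abs, Real.norm_eq_abs,
      abs_of_nonneg (by linarith), abs_of_nonneg (by linarith)]
    linarith
  · refine (hasDerivAt_const (0 : ℝ) (Real.log 4)).congr_of_eventuallyEq ?_
    filter_upwards [(tendsto_mul_exp_neg z).eventually (lt_mem_nhds h1)] with h hh
    rw [growth_of_ge hh.le]

lemma growth_antitoneOn {z z' : ℝ} (h0 : 0 < z) (h : z ≤ z') : growth z' ≤ growth z := by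
  rcases h.eq_or_lt with rfl | h
  · rfl
  rcases lt_or_ge z (1 / 2) with h1 | h1
  · exact (growth_strictAnti h0 h1 h).le
  · rw [growth_of_ge h1, growth_of_ge (h1.trans h.le)]

/-! ### Densities -/

lemma inv_mul_exp_neg (z h : ℝ) : (z * Real.exp (-h))⁻¹ = z⁻¹ * Real.exp h := by
  rw [mul_inv, Real.exp_neg, inv_inv]

lemma mul_le_of_mul_mean_le {n : ℕ} {h m x y : ℝ} (H : h * m ≤ x - y) :
    h * (m / n) ≤ x / n - y / n := by
  rw [← sub_div, mul_div_assoc']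
  exact div_le_div_of_nonneg_right H n.cast_nonneg

lemma aHat_density_tendsto {z₁ z₂ d : ℝ} (h₁ : 0 < z₁) (h₂ : 0 < z₂)
    (hd : HasDerivAt (fun h => Real.log (max (growth (z₁ * Real.exp (-h))) (growth z₂))) d 0) :
    Tendsto (fun n : ℕ => mean n z₁ z₂ aHat / (n : ℝ)) atTop (𝓝 d) := by
  refine tendsto_of_mul_le_sub (fun h => free_energy_tendsto
    (mul_pos h₁ (Real.exp_pos (-h))) h₂) (fun n h => ?_) hd
  have := mul_mean_le (n := n) (h := h) h₁ h₂ (contactWeight_mul_exp_left z₁⁻¹ z₂⁻¹ h)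
  simp only [inv_mul_exp_neg, Real.exp_zero, mul_one]
  exact mul_le_of_mul_mean_le this

lemma bHat_density_tendsto {z₁ z₂ d : ℝ} (h₁ : 0 < z₁) (h₂ : 0 < z₂)
    (hd : HasDerivAt (fun h => Real.log (max (growth (z₂ * Real.exp (-h))) (growth z₁))) d 0) :
    Tendsto (fun n : ℕ => mean n z₁ z₂ bHat / (n : ℝ)) atTop (𝓝 d) := by
  refine tendsto_of_mul_le_sub (fun h => free_energy_tendsto
    (mul_pos h₂ (Real.exp_pos (-h))) h₁) (fun n h => ?_) hd
  have := mul_mean_le (n := n) (h := h) h₁ h₂ (contactWeight_mul_exp_right z₁⁻¹ z₂⁻¹ h)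
  simp only [inv_mul_exp_neg, Real.exp_zero, mul_one, transitSum_symm n _ z₁⁻¹]
  exact mul_le_of_mul_mean_le this

lemma hasDerivAt_free_energy_of_lt {z₁ z₂ : ℝ} (h₁ : 0 < z₁) (hz : z₁ < 1 / 2) (h : z₁ < z₂) :
    HasDerivAt (fun h => Real.log (max (growth (z₁ * Real.exp (-h))) (growth z₂))) (rho z₁) 0 := by
  refine (hasDerivAt_log_growth_of_lt h₁ hz).congr_of_eventuallyEq ?_
  filter_upwards [(tendsto_mul_exp_neg z₁).eventually (gt_mem_nhds h)] with x hx
  rw [max_eq_left (growth_antitoneOn (mul_pos h₁ (Real.exp_pos _)) hx.le)]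

lemma hasDerivAt_free_energy_of_gt {z₁ z₂ : ℝ} (h₂ : 0 < z₂) (h : z₂ < z₁) :
    HasDerivAt (fun h => Real.log (max (growth (z₁ * Real.exp (-h))) (growth z₂))) 0 0 := by
  refine (hasDerivAt_const (0 : ℝ) (Real.log (growth z₂))).congr_of_eventuallyEq ?_
  filter_upwards [(tendsto_mul_exp_neg z₁).eventually (lt_mem_nhds h)] with x hx
  rw [max_eq_right (growth_antitoneOn h₂ hx.le)]

lemma hasDerivAt_free_energy_of_ge {z₁ z₂ : ℝ} (h₁ : 1 / 2 ≤ z₁) (h₂ : 1 / 2 ≤ z₂) :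
    HasDerivAt (fun h => Real.log (max (growth (z₁ * Real.exp (-h))) (growth z₂))) 0 0 := by
  convert hasDerivAt_log_growth_of_ge h₁ using 4 with x
  rw [growth_of_ge h₂, max_eq_left (four_le_growth (mul_pos (by linarith) (Real.exp_pos _)))]

/-- Scaling both fugacities by $e^{-h}$ stays on the diagonal, where the free energy is smooth; its
derivative is the total density, shared equally. -/
lemma densities_diagonal_tendsto {z : ℝ} (h0 : 0 < z) (h1 : z < 1 / 2) :
    Tendsto (fun n : ℕ => mean n z z aHat / (n : ℝ)) atTop (𝓝 (rho z / 2)) ∧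
      Tendsto (fun n : ℕ => mean n z z bHat / (n : ℝ)) atTop (𝓝 (rho z / 2)) := by
  have hsum : Tendsto (fun n : ℕ => mean n z z (fun w => aHat w + bHat w) / (n : ℝ)) atTop
      (𝓝 (rho z)) := by
    have hlim := fun h : ℝ => free_energy_tendsto (mul_pos h0 (Real.exp_pos (-h)))
      (mul_pos h0 (Real.exp_pos (-h)))
    simp only [max_self] at hlim
    refine tendsto_of_mul_le_sub hlim (fun n h => ?_) (hasDerivAt_log_growth_of_lt h0 h1)
    have := mul_mean_le (n := n) (u' := z⁻¹ * Real.exp h) (v' := z⁻¹ * Real.exp h) (h := h) h0 h0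
      (f := fun w => aHat w + bHat w) (fun w => by
        rw [contactWeight_mul_exp_left, contactWeight_mul_exp_right, mul_add, Real.exp_add]; ring)
    simp only [inv_mul_exp_neg, Real.exp_zero, mul_one]
    exact mul_le_of_mul_mean_le this
  have ha : Tendsto (fun n : ℕ => mean n z z aHat / (n : ℝ)) atTop (𝓝 (rho z / 2)) := by
    refine (hsum.div_const 2).congr fun n => ?_
    rw [mean_add, ← mean_aHat_eq_mean_bHat n h0.ne']
    ring
  exact ⟨ha, ha.congr fun n => by rw [mean_aHat_eq_mean_bHat n h0.ne']⟩

end OTW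

namespace OTW

/-! ### Local profile on the coexistence line -/

lemma mean_aHatAt_eq {n i : ℕ} (hi : 1 ≤ i) (hin : i ≤ n) {z : ℝ} (h0 : 0 < z) (h1 : z ≤ 1 / 2) :
    mean n z z (aHatAt i) = renewal z i * coexistence z (n - i) / coexistence z n := by
  have ht := mul_one_sub_pos h0 h1
  rw [mean_aHatAt hi hin h0.ne' h0.ne', renewal, coexistence, coexistence,
    ← mul_div_mul_right _ (transitSum (2 * n) z⁻¹ z⁻¹) (pow_ne_zero n ht.ne')]
  congr 1
  obtain ⟨l, rfl⟩ := Nat.exists_eq_add_of_le hin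
  rw [Nat.add_sub_cancel_left]
  ring

lemma mean_bHatAt_eq {n i : ℕ} (hi : 1 ≤ i) (hin : i ≤ n) {z : ℝ} (h0 : 0 < z) (h1 : z ≤ 1 / 2) :
    mean n z z (bHatAt i) =
      (coexistence z i - renewal z i) * renewal z (n - i) / coexistence z n := by
  have ht := mul_one_sub_pos h0 h1
  rw [mean_bHatAt hi hin h0.ne' h0.ne', renewal, renewal, coexistence, coexistence,
    ← mul_div_mul_right _ (transitSum (2 * n) z⁻¹ z⁻¹) (pow_ne_zero n ht.ne')]
  congr 1
  obtain ⟨l, rfl⟩ := Nat.exists_eq_add_of_le hin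
  rw [Nat.add_sub_cancel_left]
  ring

lemma tendsto_atTop_of_div_tendsto {i : ℕ → ℕ} {x : ℝ} (hx : 0 < x)
    (hi : Tendsto (fun n : ℕ => (i n : ℝ) / (n : ℝ)) atTop (𝓝 x)) : Tendsto i atTop atTop := by
  have h := hi.pos_mul_atTop hx tendsto_natCast_atTop_atTop
  refine tendsto_natCast_atTop_iff.1 (h.congr' ?_)
  filter_upwards [eventually_gt_atTop 0] with n hn
  have hn' : (n : ℝ) ≠ 0 := by exact_mod_cast hn.ne'
  exact div_mul_cancel₀ _ hn'

lemma coexistence_comp_div_tendsto {z : ℝ} (h0 : 0 < z) (h1 : z ≤ 1 / 2) {i : ℕ → ℕ} {x : ℝ}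
    (hx : 0 < x) (hi : Tendsto (fun n : ℕ => (i n : ℝ) / (n : ℝ)) atTop (𝓝 x)) :
    Tendsto (fun n : ℕ => coexistence z (i n) / n) atTop (𝓝 (rho z ^ 2 * x)) := by
  have hiT := tendsto_atTop_of_div_tendsto hx hi
  refine (((coexistence_div_tendsto h0 h1).comp hiT).mul hi).congr' ?_
  filter_upwards [hiT.eventually_gt_atTop 0] with n hn
  have hn' : (i n : ℝ) ≠ 0 := by exact_mod_cast hn.ne'
  simp only [Function.comp_apply]
  field_simp

lemma local_profile {z : ℝ} (h0 : 0 < z) (h1 : z ≤ 1 / 2) {x : ℝ} (hx0 : 0 < x) (hx1 : x < 1)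
    {i : ℕ → ℕ} (hi : Tendsto (fun n : ℕ => (i n : ℝ) / (n : ℝ)) atTop (𝓝 x)) :
    Tendsto (fun n : ℕ => mean n z z (aHatAt (i n))) atTop (𝓝 (rho z * (1 - x))) ∧
      Tendsto (fun n : ℕ => mean n z z (bHatAt (i n))) atTop (𝓝 (rho z * x)) := by
  have hiT := tendsto_atTop_of_div_tendsto hx0 hi
  have hle : ∀ᶠ n in atTop, i n ≤ n := by
    filter_upwards [hi.eventually (gt_mem_nhds hx1), eventually_gt_atTop 0] with n h2 hn
    have hn' : (0 : ℝ) < n := by exact_mod_cast hn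
    rw [div_lt_one hn'] at h2
    exact_mod_cast h2.le
  have hcompl : Tendsto (fun n : ℕ => ((n - i n : ℕ) : ℝ) / (n : ℝ)) atTop (𝓝 (1 - x)) := by
    refine (hi.const_sub 1).congr' ?_
    filter_upwards [hle, eventually_gt_atTop 0] with n h2 hn
    have hn' : (n : ℝ) ≠ 0 := by exact_mod_cast hn.ne'
    rw [Nat.cast_sub h2, sub_div, div_self hn']
  have hcT := tendsto_atTop_of_div_tendsto (sub_pos.2 hx1) hcompl
  have hra := (renewal_tendsto h0 h1).comp hiT
  have hrb := (renewal_tendsto h0 h1).comp hcT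
  have hma : (fun n => renewal z (i n) * coexistence z (n - i n) / coexistence z n) =ᶠ[atTop]
      fun n => mean n z z (aHatAt (i n)) := by
    filter_upwards [hle, hiT.eventually_ge_atTop 1] with n h2 h3
    rw [mean_aHatAt_eq h3 h2 h0 h1]
  have hmb : (fun n => (coexistence z (i n) - renewal z (i n)) * renewal z (n - i n) /
      coexistence z n) =ᶠ[atTop] fun n => mean n z z (bHatAt (i n)) := by
    filter_upwards [hle, hiT.eventually_ge_atTop 1] with n h2 h3
    rw [mean_bHatAt_eq h3 h2 h0 h1]
  -- At $z=1/2$ dividing by $\rho^2=0$ is impossible, but there $c_n=1$ for all $n$ and $r_n\to0$.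
  rcases h1.eq_or_lt with rfl | h1'
  · simp only [coexistence_half, rho_half, zero_mul] at *
    refine ⟨?_, ?_⟩
    · refine Tendsto.congr' hma ?_
      simpa [Function.comp_def] using hra
    · refine Tendsto.congr' hmb ?_
      simpa using (hra.const_sub 1).mul hrb
  · have hρ := (rho_pos h1').ne'
    have hn0 := coexistence_div_tendsto h0 h1
    have hρ2 : rho z ^ 2 ≠ 0 := pow_ne_zero 2 hρ
    constructor
    · have h := (hra.mul (coexistence_comp_div_tendsto h0 h1 (sub_pos.2 hx1) hcompl)).div hn0 hρ2
      rw [show rho z * (rho z ^ 2 * (1 - x)) / rho z ^ 2 = rho z * (1 - x) by field_simp] at h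
      refine (h.congr' ?_).congr' hma
      filter_upwards [eventually_gt_atTop 0] with n hn
      have hn' : (n : ℝ) ≠ 0 := by exact_mod_cast hn.ne'
      simp only [Function.comp_apply, Pi.div_apply, mul_div_assoc']
      rw [div_div_div_cancel_right₀ hn']
    · have hr0 : Tendsto (fun n => renewal z (i n) / (n : ℝ)) atTop (𝓝 0) := by
        simpa [div_eq_mul_inv] using hra.mul (tendsto_inv_atTop_nhds_zero_nat (𝕜 := ℝ))
      have h := (((coexistence_comp_div_tendsto h0 h1 hx0 hi).sub hr0).mul hrb).div hn0 hρ2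
      rw [show (rho z ^ 2 * x - 0) * rho z / rho z ^ 2 = rho z * x by field_simp; ring] at h
      refine (h.congr' ?_).congr' hmb
      filter_upwards [eventually_gt_atTop 0] with n hn
      have hn' : (n : ℝ) ≠ 0 := by exact_mod_cast hn.ne'
      simp only [Function.comp_apply, Pi.div_apply, ← sub_div, div_mul_eq_mul_div]
      rw [div_div_div_cancel_right₀ hn']

/-! ### The phase diagram -/

open Classical in
/-- The limiting density of the contacts with fugacity `p.1` in competition with contacts of
fugacity `p.2`. -/
noncomputable def density (p : ℝ × ℝ) : ℝ :=
  if p.1 < 1 / 2 ∧ p.1 < p.2 then rho p.1 else if p.1 < 1 / 2 ∧ p.1 = p.2 then rho p.1 / 2 else 0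

lemma density_of_ge {x y : ℝ} (h : 1 / 2 ≤ x) : density (x, y) = 0 := by
  rw [density, if_neg fun h' => absurd h'.1 (not_lt.2 h),
    if_neg fun h' => absurd h'.1 (not_lt.2 h)]

lemma density_of_gt {x y : ℝ} (h : y < x) : density (x, y) = 0 := by
  rw [density, if_neg fun h' => absurd h'.2 h.not_gt, if_neg fun h' => absurd h'.2 h.ne']

lemma density_of_lt {x y : ℝ} (h : x < 1 / 2) (h' : x < y) : density (x, y) = rho x := by
  rw [density, if_pos ⟨h, h'⟩]

lemma density_diagonal {z : ℝ} (h : z ≤ 1 / 2) : density (z, z) = rho z / 2 := by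
  rcases h.eq_or_lt with rfl | h
  · rw [density_of_ge le_rfl, rho_half, zero_div]
  · rw [density, if_neg fun h' => lt_irrefl _ h'.2, if_pos ⟨h, rfl⟩]

lemma densities_tendsto {z₁ z₂ : ℝ} (h₁ : 0 < z₁) (h₂ : 0 < z₂) :
    Tendsto (fun n : ℕ => mean n z₁ z₂ aHat / (n : ℝ)) atTop (𝓝 (density (z₁, z₂))) ∧
      Tendsto (fun n : ℕ => mean n z₁ z₂ bHat / (n : ℝ)) atTop (𝓝 (density (z₂, z₁))) := by
  by_cases h : 1 / 2 ≤ z₁ ∧ 1 / 2 ≤ z₂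
  · rw [density_of_ge h.1, density_of_ge h.2]
    exact ⟨aHat_density_tendsto h₁ h₂ (hasDerivAt_free_energy_of_ge h.1 h.2),
      bHat_density_tendsto h₁ h₂ (hasDerivAt_free_energy_of_ge h.2 h.1)⟩
  rcases lt_trichotomy z₁ z₂ with hlt | rfl | hlt
  · have hz : z₁ < 1 / 2 := by
      by_contra hz
      exact h ⟨not_lt.1 hz, (not_lt.1 hz).trans hlt.le⟩
    rw [density_of_lt hz hlt, density_of_gt hlt]
    exact ⟨aHat_density_tendsto h₁ h₂ (hasDerivAt_free_energy_of_lt h₁ hz hlt),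
      bHat_density_tendsto h₁ h₂ (hasDerivAt_free_energy_of_gt h₁ hlt)⟩
  · have hz : z₁ < 1 / 2 := by
      by_contra hz
      exact h ⟨not_lt.1 hz, not_lt.1 hz⟩
    rw [density_diagonal hz.le]
    exact densities_diagonal_tendsto h₁ hz
  · have hz : z₂ < 1 / 2 := by
      by_contra hz
      exact h ⟨(not_lt.1 hz).trans hlt.le, not_lt.1 hz⟩
    rw [density_of_lt hz hlt, density_of_gt hlt]
    exact ⟨aHat_density_tendsto h₁ h₂ (hasDerivAt_free_energy_of_gt h₂ hlt),
      bHat_density_tendsto h₁ h₂ (hasDerivAt_free_energy_of_lt h₂ hz hlt)⟩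

lemma not_continuousAt_of_vertical {f : ℝ × ℝ → ℝ} {z c : ℝ} (hf : ∀ y, z < y → f (z, y) = c)
    (hc : f (z, z) ≠ c) : ¬ ContinuousAt f (z, z) := by
  intro hcont
  have h1 : Tendsto (fun y : ℝ => (z, y)) (𝓝[>] z) (𝓝 (z, z)) :=
    ((Continuous.prodMk_right z).tendsto z).mono_left nhdsWithin_le_nhds
  have h2 : Tendsto (fun y : ℝ => f (z, y)) (𝓝[>] z) (𝓝 (f (z, z))) := hcont.tendsto.comp h1
  have h3 : Tendsto (fun y : ℝ => f (z, y)) (𝓝[>] z) (𝓝 c) :=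
    tendsto_const_nhds.congr' (by
      filter_upwards [self_mem_nhdsWithin] with y hy
      exact (hf y hy).symm)
  exact hc (tendsto_nhds_unique h2 h3)

lemma density_add_swap {p : ℝ × ℝ} (h₁ : p.1 < 1 / 2) (h₂ : p.2 < 1 / 2) :
    density p + density p.swap = rho (min p.1 p.2) := by
  obtain ⟨x, y⟩ := p
  simp only [Prod.swap_prod_mk] at *
  rcases lt_trichotomy x y with h | rfl | h
  · rw [density_of_lt h₁ h, density_of_gt h, add_zero, min_eq_left h.le]
  · rw [density_diagonal h₁.le, min_self, add_halves]
  · rw [density_of_gt h, density_of_lt h₂ h, zero_add, min_eq_right h.le]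

lemma continuousAt_density_add_swap {z : ℝ} (h : z < 1 / 2) :
    ContinuousAt (fun p : ℝ × ℝ => density p + density p.swap) (z, z) := by
  have hρ : ContinuousAt rho z := by
    have h1z : 1 - z ≠ 0 := by linarith
    unfold rho
    fun_prop (disch := assumption)
  have hmin : ContinuousAt (fun p : ℝ × ℝ => rho (min p.1 p.2)) (z, z) :=
    ContinuousAt.comp (g := rho) (f := fun p : ℝ × ℝ => min p.1 p.2) (by simpa using hρ)
      (continuous_fst.min continuous_snd).continuousAt
  refine hmin.congr ?_
  filter_upwards [continuous_fst.continuousAt.eventually (gt_mem_nhds (show (z, z).1 < 1 / 2 from h)),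
    continuous_snd.continuousAt.eventually (gt_mem_nhds (show (z, z).2 < 1 / 2 from h))] with p h1 h2
  exact (density_add_swap h1 h2).symm

end OTW

theorem mainTheorem5 :
    (∃ a b : ℝ × ℝ → ℝ,
      -- `a` and `b` are the limiting contact densities on the whole quadrant of fugacities
      (∀ z₁ z₂ : ℝ, 0 < z₁ → 0 < z₂ →
        Tendsto (fun n : ℕ => OTW.mean n z₁ z₂ OTW.aHat / (n : ℝ)) atTop (𝓝 (a (z₁, z₂))) ∧
        Tendsto (fun n : ℕ => OTW.mean n z₁ z₂ OTW.bHat / (n : ℝ)) atTop (𝓝 (b (z₁, z₂)))) ∧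
      -- their values
      (∀ z₁ z₂ : ℝ, 1 / 2 ≤ z₁ → 1 / 2 ≤ z₂ →
        (a (z₁, z₂), b (z₁, z₂)) = (0, 0)) ∧
      (∀ z₁ z₂ : ℝ, 0 < z₁ → z₁ < 1 / 2 → z₁ < z₂ →
        (a (z₁, z₂), b (z₁, z₂)) = (OTW.rho z₁, 0)) ∧
      (∀ z₁ z₂ : ℝ, 0 < z₂ → z₂ < 1 / 2 → z₂ < z₁ →
        (a (z₁, z₂), b (z₁, z₂)) = (0, OTW.rho z₂)) ∧
      (∀ z : ℝ, 0 < z → z ≤ 1 / 2 →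
        (a (z, z), b (z, z)) = (OTW.rho z / 2, OTW.rho z / 2)) ∧
      -- the first-order transition: the densities and their difference jump, the sum does not
      (∀ z : ℝ, 0 < z → z < 1 / 2 →
        ¬ ContinuousAt a (z, z) ∧
        ¬ ContinuousAt b (z, z) ∧
        ¬ ContinuousAt (fun p => a p - b p) (z, z) ∧
        ContinuousAt (fun p => a p + b p) (z, z))) ∧
    -- the local profile on the coexistence line
    (∀ z : ℝ, 0 < z → z ≤ 1 / 2 → ∀ x : ℝ, 0 < x → x < 1 →
      ∀ i : ℕ → ℕ, Tendsto (fun n : ℕ => (i n : ℝ) / (n : ℝ)) atTop (𝓝 x) →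
        Tendsto (fun n : ℕ => OTW.mean n z z (OTW.aHatAt (i n))) atTop
          (𝓝 (OTW.rho z * (1 - x))) ∧
        Tendsto (fun n : ℕ => OTW.mean n z z (OTW.bHatAt (i n))) atTop
          (𝓝 (OTW.rho z * x))) := by
  refine ⟨⟨OTW.density, fun p => OTW.density p.swap, fun z₁ z₂ h₁ h₂ => OTW.densities_tendsto h₁ h₂,
    fun z₁ z₂ h₁ h₂ => ?_, fun z₁ z₂ _ h₁ h => ?_, fun z₁ z₂ _ h₂ h => ?_, fun z _ h => ?_,
    fun z _ h => ?_⟩, fun z h0 h1 x hx0 hx1 i hi => OTW.local_profile h0 h1 hx0 hx1 hi⟩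
  · simp only [Prod.swap_prod_mk, OTW.density_of_ge h₁, OTW.density_of_ge h₂]
  · simp only [Prod.swap_prod_mk, OTW.density_of_lt h₁ h, OTW.density_of_gt h]
  · simp only [Prod.swap_prod_mk, OTW.density_of_gt h, OTW.density_of_lt h₂ h]
  · simp only [Prod.swap_prod_mk, OTW.density_diagonal h]
  · have hρ := OTW.rho_pos h
    have hd := OTW.density_diagonal h.le
    have ha : ∀ y, z < y → OTW.density (z, y) = OTW.rho z := fun y hy => OTW.density_of_lt h hy
    have hb : ∀ y, z < y → OTW.density (y, z) = 0 := fun y hy => OTW.density_of_gt hy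
    -- Limits along the vertical ray above $(z,z)$ against values there: $\rho$ and $\rho/2$ for
    -- $a$, $0$ and $\rho/2$ for $b$, $\rho$ and $0$ for $a-b$.
    refine ⟨OTW.not_continuousAt_of_vertical ha ?_,
      OTW.not_continuousAt_of_vertical (c := 0) hb ?_,
      OTW.not_continuousAt_of_vertical (c := OTW.rho z) (fun y hy => ?_) ?_,
      OTW.continuousAt_density_add_swap h⟩
    · rw [hd]; linarith
    · rw [Prod.swap_prod_mk, hd]; linarith
    · simp only [Prod.swap_prod_mk, ha y hy, hb y hy, sub_zero]
    · simp only [Prod.swap_prod_mk, sub_self]; exact hρ.ne
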